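/- Let $\Gamma$ be a directed graph with vertices $1,\dots,n$ and edges $1,\dots,2n-2$, edge $e$ going from $s(e)$ to $t(e)$. For $t\in\mathbb R$ let $\tilde\beta_\Gamma^t$ be the complex-valued $(2n-4)$-form $$ \tilde\beta_\Gamma^t=\sum_{e\neq e'}\operatorname{sgn}(e',e)\,\frac1{\pi i}\log|z_{s(e')}-z_{t(e')}|\prod_{e''\neq e,e'}\frac1{2\pi i}\Big((1-t)\,d\log(z_{s(e'')}-z_{t(e'')})+t\,d\log(\bar z_{s(e'')}-\bar z_{t(e'')})\Big) $$ on the space $\mathrm{Conf}_n$ of $n$ distinct points $z_1,\dots,z_n$ of $\mathbb C$. Here $e,e'$ run over the edges of $\Gamma$, the product is the wedge product in the order of the edges, and $\operatorname{sgn}(e',e)$ is the sign of the permutation that moves $e',e$ (in this order) to the front of the list of edges and keeps the order of the others. Let $$c_\Gamma^t=\int_{\mathrm{Conf}_n/(\mathbb C^\times\ltimes\mathbb C)}\tilde\beta_\Gamma^t ,$$ where the quotient by rotations, scalings and translations is identified with the space $\{(z_3,\dots,z_n)\}$ of configurations of $n-2$ distinct points of $\mathbb C\smallsetminus\{0,1\}$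 by setting $z_1=0$, $z_2=1$, and carries its complex orientation; this is the weight of $\Gamma$ in the graph cocycle $x^t=\sum_\Gamma c_\Gamma^t\,\Gamma$. **Proposition.** Let $\Gamma$ be the tetrahedron graph ($n=4$, exactly one edge between any two distinct vertices), with any numbering and any directions of its six edges. Then the integral defining $c_\Gamma^{1/2}$ converges absolutely, and $c_\Gamma^{1/2}$ is a non-zero rational multiple of $\zeta(3)/(\pi i)^3$; that is, $c_\Gamma^{1/2}=q\, i\,\zeta(3)/\pi^3$ for some $q\in\mathbb Q\smallsetminus\{0\}$. -/

import Mathlib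

open MeasureTheory

namespace GraphWeight

/-- A directed graph with vertex set `Fin n` and (totally ordered) edge set `Fin k`. -/
structure DirGraph (n k : ℕ) where
  src : Fin k → Fin n
  tgt : Fin k → Fin n

/-- `Γ` is the tetrahedron graph: four vertices, six edges, and exactly one edge between any two
distinct vertices.  The numbering and the directions of the edges are arbitrary. -/
def DirGraph.IsTetrahedron (Γ : DirGraph 4 6) : Prop :=
  ∀ a b : Fin 4, a ≠ b →
    ∃! e : Fin 6, (Γ.src e = a ∧ Γ.tgt e = b) ∨ (Γ.src e = b ∧ Γ.tgt e = a)

/-- The configurations of `n` distinct points in the complex plane. -/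
def Conf (n : ℕ) : Set (Fin n → ℂ) := {p | Function.Injective p}

/-- Complex valued real-linear forms on the tangent space `ℂⁿ` of `Conf n`. -/
abbrev OneForm (n : ℕ) := (Fin n → ℂ) →ₗ[ℝ] ℂ

/-- The value at `p` of the `1`-form `d log (z_a - z_b)`. -/
noncomputable def dlog {n : ℕ} (p : Fin n → ℂ) (a b : Fin n) : OneForm n :=
  (p a - p b)⁻¹ •
    ((LinearMap.proj a : (Fin n → ℂ) →ₗ[ℝ] ℂ) - (LinearMap.proj b : (Fin n → ℂ) →ₗ[ℝ] ℂ))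

/-- The value at `p` of the `1`-form `d log (conj z_a - conj z_b)`. -/
noncomputable def dlogConj {n : ℕ} (p : Fin n → ℂ) (a b : Fin n) : OneForm n :=
  Complex.conjAe.toLinearMap ∘ₗ dlog p a b

/-- The value at `p` of the `1`-form attached to an edge from `a` to `b`. -/
noncomputable def propagator {n : ℕ} (t : ℝ) (p : Fin n → ℂ) (a b : Fin n) : OneForm n :=
  (1 / (2 * (Real.pi : ℂ) * Complex.I)) •
    ((1 - (t : ℂ)) • dlog p a b + (t : ℂ) • dlogConj p a b)

/-- The ordered wedge product `η 0 ∧ η 1 ∧ ⋯` of `k` one-forms, that is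
`(v₁, …, v_k) ↦ ∑ σ, sign σ * ∏ i, η i (v (σ i))`. -/
noncomputable def wedge {n k : ℕ} (η : Fin k → OneForm n) :
    (Fin n → ℂ) [⋀^Fin k]→ₗ[ℝ] ℂ :=
  MultilinearMap.alternatization ((MultilinearMap.mkPiAlgebra ℝ (Fin k) ℂ).compLinearMap η)

theorem wedge_apply {n k : ℕ} (η : Fin k → OneForm n) (v : Fin k → Fin n → ℂ) :
    wedge η v = Matrix.det (Matrix.of fun i j => η i (v j)) := by
  rw [← Matrix.det_transpose, Matrix.det_apply]
  simp [wedge, MultilinearMap.alternatization_apply]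

/-- The sign of the permutation moving the labels `a`, `b` (in this order) to the front of the
ordered list of all labels and keeping the order of the others.  Labels start at `0`. -/
def orderSign {k : ℕ} (a b : Fin k) : ℤ :=
  (-1) ^ (a : ℕ) * (-1) ^ ((b : ℕ) - if a < b then 1 else 0)

/-- The weight form at `p`:
`∑_{e' ≠ e} orderSign e' e * (1 / (π i)) log |z_{s(e')} - z_{t(e')}| * ∏_{e'' ≠ e, e'} ω_{e''}`,
the product being the wedge product of the propagators in the order of the edges.

`e'.succAbove` is the increasing enumeration of the edges different from `e'`, so `e` runs over
`e'.succAbove j`, and the remaining edges are, in increasing order, the edges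
`e'.succAbove (j.succAbove i)`. -/
noncomputable def weightForm {n k : ℕ} (t : ℝ) (Γ : DirGraph n (k + 2)) (p : Fin n → ℂ) :
    (Fin n → ℂ) [⋀^Fin k]→ₗ[ℝ] ℂ :=
  ∑ e' : Fin (k + 2), ∑ j : Fin (k + 1),
    ((orderSign e' (e'.succAbove j) : ℂ) *
      (1 / ((Real.pi : ℂ) * Complex.I) * (Real.log ‖p (Γ.src e') - p (Γ.tgt e')‖ : ℂ))) •
    wedge fun i : Fin k =>
      propagator t p (Γ.src (e'.succAbove (j.succAbove i))) (Γ.tgt (e'.succAbove (j.succAbove i)))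

/-- The section `(z₁, …, z_m) ↦ (0, 1, z₁, …, z_m)`; over the configurations of `m` distinct
points of `ℂ ∖ {0, 1}` it meets every orbit of `z ↦ a z + b` (`a ∈ ℂˣ`, `b ∈ ℂ`) on
`Conf (m + 2)` exactly once. -/
def sect {m : ℕ} (z : Fin m → ℂ) : Fin (m + 2) → ℂ :=
  Fin.cons 0 (Fin.cons 1 z)

/-- The configurations of `m` distinct points of `ℂ ∖ {0, 1}`, i.e. `Conf (m + 2)` modulo
rotations, scalings and translations. -/
def ConfQuot (m : ℕ) : Set (Fin m → ℂ) := {z | sect z ∈ Conf (m + 2)}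

/-- The oriented real basis `(∂x₁, ∂y₁, ∂x₂, ∂y₂, …)` of `ℂᵐ`. -/
def stdFrame {m : ℕ} (a : Fin (m * 2)) : Fin m → ℂ :=
  Pi.single a.divNat (if a.modNat = 0 then 1 else Complex.I)

/-- The coefficient with respect to `dx₁ ∧ dy₁ ∧ dx₂ ∧ dy₂ ∧ ⋯` of the pullback along `sect` of the
weight form; for a graph with `m + 2` vertices and `2 m + 2` edges this is a form of top degree. -/
noncomputable def weightDensity {m : ℕ} (t : ℝ) (Γ : DirGraph (m + 2) (m * 2 + 2))
    (z : Fin m → ℂ) : ℂ :=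
  (weightForm t Γ (sect z)).compLinearMap (fderiv ℝ sect z).toLinearMap stdFrame

/-- The integral weight `c_Γ^t`, the coefficient of `Γ` in `x^t`: the integral of the weight form
over `Conf (m + 2)` modulo rotations, scalings and translations. -/
noncomputable def weight {m : ℕ} (t : ℝ) (Γ : DirGraph (m + 2) (m * 2 + 2)) : ℂ :=
  ∫ z in ConfQuot m, weightDensity t Γ z

end GraphWeight

namespace GraphWeight

/-! At t = 1/2 every propagator is d log|z_a - z_b| / (2πi), so up to a constant the weight density
is a real 6 × 6 determinant with one row per edge: the logarithm of the length, the number 1, and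
the four components of d log of the length. Laplace expansion along the first two columns is exactly
the signed sum over (e', e). Reversing an edge fixes its row and renumbering permutes rows, so a
single tetrahedron has to be treated, up to sign.

With z₁ = 0 and z₂ = 1 the row of the edge 01 is (0, 1, 0, ..., 0), and the determinant becomes a
sum of five densities, one for each remaining edge carrying the logarithm. Four of them are related
by the symmetries z ↦ 1 - z and z ↔ w. The projective substitution `edgeSwap` turns such a term into
the fifth, `mainTerm`, plus a product whose integral vanishes because `logJac₀` is odd under
conjugation. Hence the integral is -5 ∫ `mainTerm`.

This last integral is the logarithmic energy of `logJac₀`. In coordinates z = exp(x + iθ) the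
density becomes ∑ exp(-n|x|) sin nθ and the kernel becomes max(x, y) - ∑ exp(-n|x - y|) cos n(θ - φ)
/ n, with n ≥ 1. Parseval in both angles and elementary integrals in x and y leave -π² ∑ (1/n) ·
3/(2n²) = -(3/2) π² ζ(3) (`hasSum_integral_mainTerm`). -/

/-! ### The weight form at t = 1/2 as a real determinant -/

/-- Laplace expansion along column 0, then along column 1. The position of the second row in the
shortened list drops by one when it comes after the first, which is the correction in `orderSign`.
-/
theorem det_eq_sum_pair {R : Type*} [CommRing R] {k : ℕ}
    (A : Matrix (Fin (k + 2)) (Fin (k + 2)) R) :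
    A.det = ∑ i : Fin (k + 2), ∑ j : Fin (k + 1), ((orderSign i (i.succAbove j) : ℤ) : R) *
      A i 0 * A (i.succAbove j) 1 *
        (Matrix.of fun a b : Fin k => A (i.succAbove (j.succAbove a)) b.succ.succ).det := by
  rw [Matrix.det_succ_column_zero]
  refine Finset.sum_congr rfl fun i _ => ?_
  rw [Matrix.det_succ_column_zero, Finset.mul_sum]
  refine Finset.sum_congr rfl fun j _ => ?_
  have hs : orderSign i (i.succAbove j) = (-1) ^ (i : ℕ) * (-1) ^ (j : ℕ) := by
    unfold orderSign
    congr 2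
    by_cases h : j.castSucc < i
    · rw [Fin.succAbove_of_castSucc_lt _ _ h]
      simp [not_lt.2 h.le]
    · rw [Fin.succAbove_of_le_castSucc _ _ (not_lt.1 h)]
      have : i < j.succ := lt_of_le_of_lt (not_lt.1 h) (Fin.castSucc_lt_succ)
      simp [this]
  rw [hs]
  push_cast
  simp only [Matrix.submatrix_apply, Fin.succ_zero_eq_one]
  have : ((A.submatrix i.succAbove Fin.succ).submatrix j.succAbove Fin.succ) =
    (Matrix.of fun a b : Fin k => A (i.succAbove (j.succAbove a)) b.succ.succ) := rfl
  rw [this]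
  ring

/-- The average of dlog and its conjugate is its real part, that is d log|z_a - z_b|. -/
theorem propagator_half_apply {n : ℕ} (p : Fin n → ℂ) (a b : Fin n) (v : Fin n → ℂ) :
    propagator (1 / 2) p a b v =
      1 / (2 * (Real.pi : ℂ) * Complex.I) * (((p a - p b)⁻¹ * (v a - v b)).re : ℂ) := by
  simp only [propagator, dlogConj, dlog, LinearMap.smul_apply, LinearMap.add_apply,
    LinearMap.comp_apply, LinearMap.sub_apply, LinearMap.proj_apply, smul_eq_mul]
  congr 1
  rw [Complex.re_eq_add_conj]
  simp
  ring

theorem fderiv_sect_apply {m : ℕ} (z v : Fin m → ℂ) :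
    fderiv ℝ (sect (m := m)) z v = Fin.cons 0 (Fin.cons 0 v) := by
  have : HasFDerivAt (sect (m := m))
      (ContinuousLinearMap.pi (Fin.cons 0 (Fin.cons 0 fun i => ContinuousLinearMap.proj i) :
        Fin (m + 2) → ((Fin m → ℂ) →L[ℝ] ℂ))) z := by
    rw [hasFDerivAt_pi']
    intro i
    refine Fin.cases ?_ (fun i => Fin.cases ?_ (fun i => ?_) i) i
    · simpa [sect] using hasFDerivAt_const (0 : ℂ) z
    · simpa [sect] using hasFDerivAt_const (1 : ℂ) z
    · simp only [sect, Fin.cons_succ]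
      exact hasFDerivAt_apply i z
  rw [this.fderiv]
  funext i
  refine Fin.cases ?_ (fun i => Fin.cases ?_ (fun i => ?_) i) i <;> simp

/-- The real row attached to an edge from `a` to `b`: the logarithm of its length, the number `1`
and the values of the differential of the logarithm on the vectors `v`. -/
noncomputable def logRow {n k : ℕ} (p : Fin n → ℂ) (v : Fin k → Fin n → ℂ) (a b : Fin n) :
    Fin (k + 2) → ℝ :=
  Fin.cons (Real.log ‖p a - p b‖) (Fin.cons 1 fun i => ((p a - p b)⁻¹ * (v i a - v i b)).re)

theorem logRow_comm {n k : ℕ} (p : Fin n → ℂ) (v : Fin k → Fin n → ℂ) (a b : Fin n) :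
    logRow p v a b = logRow p v b a := by
  have h : (p a - p b)⁻¹ = -(p b - p a)⁻¹ := by rw [← inv_neg, neg_sub]
  unfold logRow
  rw [norm_sub_rev (p a) (p b), h]
  congr 2
  funext i
  rw [neg_mul_comm, neg_sub]

/-- The logarithm column supplies the factor of e', the column of ones supplies the omitted edge e,
and the complementary minor is the wedge of the remaining propagators. -/
theorem weightForm_half_apply {n k : ℕ} (Γ : DirGraph n (k + 2)) (p : Fin n → ℂ)
    (v : Fin k → Fin n → ℂ) :
    weightForm (1 / 2) Γ p v =
      1 / ((Real.pi : ℂ) * Complex.I) * (1 / (2 * (Real.pi : ℂ) * Complex.I)) ^ k *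
        ((Matrix.of fun e => logRow p v (Γ.src e) (Γ.tgt e)).det : ℝ) := by
  rw [det_eq_sum_pair]
  unfold weightForm
  have hs : ∀ {ι : Type} (s : Finset ι) (f : ι → (Fin n → ℂ) [⋀^Fin k]→ₗ[ℝ] ℂ),
      (∑ i ∈ s, f i) v = ∑ i ∈ s, f i v := fun s f =>
    map_sum (⟨⟨fun g => g v, rfl⟩, fun _ _ => rfl⟩ : ((Fin n → ℂ) [⋀^Fin k]→ₗ[ℝ] ℂ) →+ ℂ) f s
  rw [hs]
  push_cast
  rw [Finset.mul_sum]
  refine Finset.sum_congr rfl fun i _ => ?_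
  rw [hs, Finset.mul_sum]
  refine Finset.sum_congr rfl fun j _ => ?_
  rw [AlternatingMap.smul_apply, wedge_apply]
  have : (Matrix.of fun (a b : Fin k) => (propagator (1 / 2) p
        (Γ.src (i.succAbove (j.succAbove a))) (Γ.tgt (i.succAbove (j.succAbove a)))) (v b)) =
      (1 / (2 * (Real.pi : ℂ) * Complex.I)) •
        (Matrix.of fun a b : Fin k => logRow p v (Γ.src (i.succAbove (j.succAbove a)))
          (Γ.tgt (i.succAbove (j.succAbove a))) b.succ.succ).map (Complex.ofRealHom) := by
    ext a b
    simp only [Matrix.of_apply, propagator_half_apply, Matrix.smul_apply, Matrix.map_apply,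
      Complex.ofRealHom_eq_coe, smul_eq_mul]
    rfl
  rw [this, Matrix.det_smul, ← RingHom.mapMatrix_apply, ← RingHom.map_det]
  have h1 : ∀ a b, logRow p v a b 1 = 1 := fun a b => rfl
  have h0 : ∀ a b, logRow p v a b 0 = Real.log ‖p a - p b‖ := fun a b => rfl
  simp only [Fintype.card_fin, Matrix.of_apply, h1, h0, Complex.ofRealHom_eq_coe, smul_eq_mul,
    Complex.ofReal_one, mul_one]
  ring

theorem weightDensity_half_eq {m : ℕ} (Γ : DirGraph (m + 2) (m * 2 + 2)) (z : Fin m → ℂ) :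
    weightDensity (1 / 2) Γ z =
      1 / ((Real.pi : ℂ) * Complex.I) * (1 / (2 * (Real.pi : ℂ) * Complex.I)) ^ (m * 2) *
        ((Matrix.of fun e => logRow (sect z)
          (fun a => (Fin.cons 0 (Fin.cons 0 (stdFrame a)) : Fin (m + 2) → ℂ))
          (Γ.src e) (Γ.tgt e)).det : ℝ) := by
  rw [← weightForm_half_apply, weightDensity, AlternatingMap.compLinearMap_apply]
  congr 1
  funext a
  exact fderiv_sect_apply z (stdFrame a)

/-- The vectors of the real frame of `ℂ²`, pushed forward along `sect`. -/
noncomputable def sectFrame (a : Fin 4) : Fin 4 → ℂ :=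
  ![![0, 0, 1, 0], ![0, 0, Complex.I, 0], ![0, 0, 0, 1], ![0, 0, 0, Complex.I]] a

theorem weightDensity_half (Γ : DirGraph 4 6) (z : Fin 2 → ℂ) :
    weightDensity (m := 2) (1 / 2) Γ z =
      1 / ((Real.pi : ℂ) * Complex.I) * (1 / (2 * (Real.pi : ℂ) * Complex.I)) ^ 4 *
        ((Matrix.of fun e => logRow ![0, 1, z 0, z 1] sectFrame (Γ.src e) (Γ.tgt e)).det : ℝ) := by
  have h1 : sect z = ![0, 1, z 0, z 1] := by
    funext i; fin_cases i <;> rfl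
  have h2 : (fun a => (Fin.cons 0 (Fin.cons 0 (stdFrame (m := 2) a)) : Fin 4 → ℂ)) =
      sectFrame := by
    funext a i
    fin_cases a <;> fin_cases i <;>
      simp [stdFrame, sectFrame, Fin.divNat, Fin.modNat, Fin.cons, Fin.cases] <;> rfl
  rw [← h1, ← h2]
  exact weightDensity_half_eq Γ z

/-! ### Independence of the numbering and directions of the edges -/

/-- The edges of the tetrahedron in lexicographic order. -/
def lexEdge : Fin 6 → Fin 4 × Fin 4 := ![(0, 1), (0, 2), (1, 2), (0, 3), (1, 3), (2, 3)]

theorem exists_perm_of_isTetrahedron {Γ : DirGraph 4 6} (hΓ : Γ.IsTetrahedron) :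
    ∃ σ : Equiv.Perm (Fin 6), ∀ e,
      (Γ.src (σ e) = (lexEdge e).1 ∧ Γ.tgt (σ e) = (lexEdge e).2) ∨
      (Γ.src (σ e) = (lexEdge e).2 ∧ Γ.tgt (σ e) = (lexEdge e).1) := by
  have hne : ∀ e, (lexEdge e).1 < (lexEdge e).2 := by decide
  have hinj : Function.Injective lexEdge := by decide
  choose f hf _ using fun e => hΓ (lexEdge e).1 (lexEdge e).2 (hne e).ne
  have hfi : Function.Injective f := by
    intro a b hab
    apply hinj
    have ha := hf a
    have hb := hf b
    have ha' := hne a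
    have hb' := hne b
    simp only [hab] at ha
    ext1 <;> grind
  exact ⟨Equiv.ofBijective f (Finite.injective_iff_bijective.1 hfi), hf⟩

/-- The sign does not depend on the point or the frame, so it can be taken out of the integral. -/
theorem det_logRow_of_isTetrahedron {Γ : DirGraph 4 6} (hΓ : Γ.IsTetrahedron) :
    ∃ s : ℤˣ, ∀ (p : Fin 4 → ℂ) (v : Fin 4 → Fin 4 → ℂ),
      (Matrix.of fun e => logRow p v (Γ.src e) (Γ.tgt e)).det =
        ((s : ℤ) : ℝ) * (Matrix.of fun e => logRow p v (lexEdge e).1 (lexEdge e).2).det := by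
  obtain ⟨σ, hσ⟩ := exists_perm_of_isTetrahedron hΓ
  refine ⟨Equiv.Perm.sign σ, fun p v => ?_⟩
  have : (Matrix.of fun e => logRow p v (lexEdge e).1 (lexEdge e).2) =
      (Matrix.of fun e => logRow p v (Γ.src e) (Γ.tgt e)).submatrix σ id := by
    ext e i
    rcases hσ e with h | h
    · simp [h.1, h.2]
    · simp [h.1, h.2, logRow_comm p v (lexEdge e).1]
  rw [this, Matrix.det_permute, ← mul_assoc, ← Int.cast_mul, ← Units.val_mul, Int.units_mul_self]
  simp

/-! ### Splitting the density into five terms -/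

/-- The Jacobian of `(log |z - p|, log |z - q|)` in terms of the differences `a`, `b`. -/
noncomputable def logJac (a b : ℂ) : ℝ :=
  (a.re * b.im - a.im * b.re) / (Complex.normSq a * Complex.normSq b)

/-- The Jacobian of `(log |z|, log |z - 1|)`. -/
noncomputable def logJac₀ (z : ℂ) : ℝ := logJac z (z - 1)

/-- The density of `log |z| dlog |z - 1| dlog |z - w| dlog |w| dlog |w - 1|`. -/
noncomputable def sideTerm (x : ℂ × ℂ) : ℝ :=
  Real.log ‖x.1‖ * logJac (x.1 - 1) (x.1 - x.2) * logJac₀ x.2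

/-- The density of `log |z - w| dlog |z| dlog |z - 1| dlog |w| dlog |w - 1|`. -/
noncomputable def mainTerm (x : ℂ × ℂ) : ℝ :=
  Real.log ‖x.1 - x.2‖ * logJac₀ x.1 * logJac₀ x.2

theorem logJac_eq (a b : ℂ) :
    logJac a b = (a⁻¹).re * (b⁻¹ * Complex.I).re - (a⁻¹ * Complex.I).re * (b⁻¹).re := by
  simp only [logJac, Complex.mul_I_re, Complex.inv_re, Complex.inv_im, div_eq_mul_inv, mul_inv]
  ring

theorem logJac_neg_neg (a b : ℂ) : logJac (-a) (-b) = logJac a b := by simp [logJac]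

theorem logJac_swap (a b : ℂ) : logJac b a = -logJac a b := by
  simp only [logJac, mul_comm (Complex.normSq b), ← neg_div]
  ring

/-- The first row is that of the edge 01, of constant length 1. The last row is opposite in its z
and w blocks because log|z - w| depends only on the difference. -/
theorem det_sparse (u₁ u₂ u₃ u₄ u₅ a₁ b₁ a₂ b₂ a₃ b₃ a₄ b₄ a₅ b₅ : ℝ) :
    (!![0, 1, 0, 0, 0, 0; u₁, 1, a₁, b₁, 0, 0; u₂, 1, a₂, b₂, 0, 0; u₃, 1, 0, 0, a₃, b₃;
      u₄, 1, 0, 0, a₄, b₄; u₅, 1, a₅, b₅, -a₅, -b₅] : Matrix (Fin 6) (Fin 6) ℝ).det =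
      -(u₅ * (a₁ * b₂ - b₁ * a₂) * (a₃ * b₄ - b₃ * a₄) +
        u₁ * (a₂ * b₅ - b₂ * a₅) * (a₃ * b₄ - b₃ * a₄) -
        u₂ * (a₁ * b₅ - b₁ * a₅) * (a₃ * b₄ - b₃ * a₄) -
        u₃ * (a₄ * b₅ - b₄ * a₅) * (a₁ * b₂ - b₁ * a₂) +
        u₄ * (a₃ * b₅ - b₃ * a₅) * (a₁ * b₂ - b₁ * a₂)) := by
  simp [Matrix.det_succ_row_zero, Fin.sum_univ_succ, Fin.succAbove, Matrix.submatrix]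
  ring

theorem logRow_four {n : ℕ} (p : Fin n → ℂ) (v : Fin 4 → Fin n → ℂ) (a b : Fin n) :
    logRow p v a b = ![Real.log ‖p a - p b‖, 1, ((p a - p b)⁻¹ * (v 0 a - v 0 b)).re,
      ((p a - p b)⁻¹ * (v 1 a - v 1 b)).re, ((p a - p b)⁻¹ * (v 2 a - v 2 b)).re,
      ((p a - p b)⁻¹ * (v 3 a - v 3 b)).re] := by
  funext i
  fin_cases i <;> rfl

theorem det_logRow_lexEdge (z w : ℂ) :
    (Matrix.of fun e => logRow ![0, 1, z, w] sectFrame (lexEdge e).1 (lexEdge e).2).det =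
      -(mainTerm (z, w) + sideTerm (z, w) + sideTerm (1 - z, 1 - w) + sideTerm (w, z) +
        sideTerm (1 - w, 1 - z)) := by
  have e2 : (1 - z)⁻¹ = -(z - 1)⁻¹ := by rw [← neg_sub, inv_neg]
  have e4 : (1 - w)⁻¹ = -(w - 1)⁻¹ := by rw [← neg_sub, inv_neg]
  have e5 : (w - z)⁻¹ = -(z - w)⁻¹ := by rw [← neg_sub, inv_neg]
  have hM : (Matrix.of fun e => logRow ![0, 1, z, w] sectFrame (lexEdge e).1 (lexEdge e).2) =
    !![0, 1, 0, 0, 0, 0;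
      Real.log ‖z‖, 1, (z⁻¹).re, (z⁻¹ * Complex.I).re, 0, 0;
      Real.log ‖z - 1‖, 1, ((z - 1)⁻¹).re, ((z - 1)⁻¹ * Complex.I).re, 0, 0;
      Real.log ‖w‖, 1, 0, 0, (w⁻¹).re, (w⁻¹ * Complex.I).re;
      Real.log ‖w - 1‖, 1, 0, 0, ((w - 1)⁻¹).re, ((w - 1)⁻¹ * Complex.I).re;
      Real.log ‖z - w‖, 1, ((z - w)⁻¹).re, ((z - w)⁻¹ * Complex.I).re,
        -((z - w)⁻¹).re, -((z - w)⁻¹ * Complex.I).re] := by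
    funext e
    change logRow ![0, 1, z, w] sectFrame (lexEdge e).1 (lexEdge e).2 = _
    rw [logRow_four]
    fin_cases e <;> simp [lexEdge, sectFrame, norm_sub_rev 1 z, norm_sub_rev 1 w, e2, e4,
      -Complex.inv_re, -Complex.inv_im, -Complex.mul_re, -Complex.mul_im] <;> rfl
  rw [hM, det_sparse]
  have n1 : ‖1 - z‖ = ‖z - 1‖ := norm_sub_rev _ _
  have n2 : ‖1 - w‖ = ‖w - 1‖ := norm_sub_rev _ _
  have g1 : logJac₀ (1 - z) = -logJac₀ z := by
    rw [logJac₀, logJac₀, logJac_swap (z - 1) z, show (1 : ℂ) - z - 1 = -z by ring,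
      show (1 : ℂ) - z = -(z - 1) by ring, logJac_neg_neg, neg_neg]
  have g2 : logJac₀ (1 - w) = -logJac₀ w := by
    rw [logJac₀, logJac₀, logJac_swap (w - 1) w, show (1 : ℂ) - w - 1 = -w by ring,
      show (1 : ℂ) - w = -(w - 1) by ring, logJac_neg_neg, neg_neg]
  have k1 : logJac (1 - z - 1) (1 - z - (1 - w)) = logJac z (z - w) := by
    rw [← logJac_neg_neg]; congr 1 <;> ring
  have k2 : logJac (1 - w - 1) (1 - w - (1 - z)) = logJac w (w - z) := by
    rw [← logJac_neg_neg]; congr 1 <;> ring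
  simp only [mainTerm, sideTerm, n1, n2, g1, g2, k1, k2]
  simp only [logJac₀, logJac_eq, e5, neg_mul, Complex.neg_re]
  ring

/-! ### Absolute convergence of the main term -/

@[fun_prop]
theorem measurable_logJac₀ : Measurable logJac₀ := by
  unfold logJac₀ logJac
  fun_prop

/-- A radial majorant on `ℂ`: an integrable singularity at `0` and integrable decay. -/
noncomputable def radialBound (r : ℝ) : ℝ := (r * √r * (1 + r))⁻¹

theorem radialBound_nonneg {r : ℝ} (hr : 0 ≤ r) : 0 ≤ radialBound r := by
  unfold radialBound; positivity

/-- In polar coordinates the integrand is at most r^(-1/2) near 0 and r^(-3/2) near infinity. -/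
theorem integrable_radialBound_norm : Integrable fun z : ℂ => radialBound ‖z‖ := by
  rw [integrable_fun_norm_addHaar, Complex.finrank_real_complex]
  have hm : Measurable fun y : ℝ => y ^ (2 - 1) • radialBound y := by
    unfold radialBound; fun_prop
  rw [← Set.Ioc_union_Ioi_eq_Ioi (zero_le_one (α := ℝ))]
  refine IntegrableOn.union ?_ ?_
  · have h : IntegrableOn (fun y : ℝ => y ^ (-(1 / 2) : ℝ)) (Set.Ioc 0 1) :=
      (intervalIntegrable_iff_integrableOn_Ioc_of_le zero_le_one).1
        (intervalIntegral.intervalIntegrable_rpow' (by norm_num))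
    refine Integrable.mono' h hm.aestronglyMeasurable ?_
    filter_upwards [ae_restrict_mem measurableSet_Ioc] with y hy
    have h0 : 0 < √y := Real.sqrt_pos.2 hy.1
    have hy0 := hy.1
    rw [Real.rpow_neg hy.1.le, ← Real.sqrt_eq_rpow]
    simp only [radialBound, Nat.add_one_sub_one, pow_one, smul_eq_mul]
    rw [Real.norm_of_nonneg (by positivity), mul_assoc, mul_inv, mul_inv_cancel_left₀ hy.1.ne']
    exact inv_anti₀ h0 (le_mul_of_one_le_right h0.le (by linarith))
  · have h : IntegrableOn (fun y : ℝ => y ^ (-(3 / 2) : ℝ)) (Set.Ioi 1) :=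
      integrableOn_Ioi_rpow_of_lt (by norm_num) one_pos
    refine Integrable.mono' h hm.aestronglyMeasurable ?_
    filter_upwards [ae_restrict_mem measurableSet_Ioi] with y hy
    have hy0 : 0 < y := one_pos.trans hy
    have h0 : 0 < √y := Real.sqrt_pos.2 hy0
    rw [Real.rpow_neg hy0.le, show (3 / 2 : ℝ) = 1 + 1 / 2 by norm_num, Real.rpow_add hy0,
      Real.rpow_one, ← Real.sqrt_eq_rpow]
    simp only [radialBound, Nat.add_one_sub_one, pow_one, smul_eq_mul]
    rw [Real.norm_of_nonneg (by positivity), mul_assoc, mul_inv, mul_inv_cancel_left₀ hy0.ne',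
      mul_comm y]
    exact inv_anti₀ (by positivity) (by gcongr; linarith)

/-- An integrable majorant on `ℂ` with singularities at `0` and `1`. -/
noncomputable def twoPointBound (w : ℂ) : ℝ := radialBound ‖w‖ + radialBound ‖w - 1‖

theorem integrable_twoPointBound : Integrable twoPointBound :=
  integrable_radialBound_norm.add (integrable_radialBound_norm.comp_sub_right 1)

theorem abs_logJac₀ (w : ℂ) : |logJac₀ w| = |w.im| / (‖w‖ ^ 2 * ‖w - 1‖ ^ 2) := by
  have : w.re * (w - 1).im - w.im * (w - 1).re = w.im := by simp; ring
  rw [logJac₀, logJac, this, abs_div, ← Complex.sq_norm, ← Complex.sq_norm, abs_of_nonneg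
    (by positivity : 0 ≤ ‖w‖ ^ 2 * ‖w - 1‖ ^ 2)]

/-- The numerator |Im w| is at most the distance to either puncture, so each singularity has order
only 1. Here r is the distance to 0 or to 1, chosen so that the other distance is at least 1/2. -/
theorem exists_abs_logJac₀_le (w : ℂ) : ∃ r : ℝ, 0 ≤ r ∧ radialBound r ≤ twoPointBound w ∧
    ‖w‖ ≤ 1 + r ∧ |logJac₀ w| ≤ 25 / (r * (1 + r) ^ 2) := by
  have key : ∀ a b i : ℝ, 0 ≤ a → 0 ≤ b → |i| ≤ a → 1 + a ≤ 5 * b →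
      |i| / (a ^ 2 * b ^ 2) ≤ 25 / (a * (1 + a) ^ 2) := by
    intro a b i ha hb hi hab
    rcases ha.eq_or_lt with rfl | ha
    · simp
    have hb : 0 < b := by linarith
    rw [div_le_div_iff₀ (by positivity) (by positivity)]
    have h1 : (1 + a) ^ 2 ≤ (5 * b) ^ 2 := by gcongr
    calc |i| * (a * (1 + a) ^ 2) ≤ a * (a * (5 * b) ^ 2) := by gcongr
      _ = 25 * (a ^ 2 * b ^ 2) := by ring
  have t1 : ‖w‖ ≤ ‖w - 1‖ + 1 := by simpa using norm_add_le (w - 1) 1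
  have t2 : ‖w - 1‖ ≤ ‖w‖ + 1 := by simpa using norm_sub_le w 1
  have t3 : (1 : ℝ) ≤ ‖w‖ + ‖w - 1‖ := by simpa using norm_sub_le w (w - 1)
  have p1 := radialBound_nonneg (norm_nonneg w)
  have p2 := radialBound_nonneg (norm_nonneg (w - 1))
  rw [abs_logJac₀]
  -- If the other distance b is at least 1/2, then 1 + r ≤ b + 2 ≤ 5b; this is the source of the
  -- constant 25 = 5².
  by_cases h : 1 / 2 ≤ ‖w - 1‖
  · refine ⟨‖w‖, norm_nonneg _, by unfold twoPointBound; linarith, by linarith, ?_⟩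
    exact key _ _ _ (norm_nonneg _) (norm_nonneg _) (Complex.abs_im_le_norm w) (by linarith)
  · refine ⟨‖w - 1‖, norm_nonneg _, by unfold twoPointBound; linarith, by linarith, ?_⟩
    rw [mul_comm (‖w‖ ^ 2)]
    refine key _ _ _ (norm_nonneg _) (norm_nonneg _) ?_ (by linarith)
    simpa using Complex.abs_im_le_norm (w - 1)

/-- The spare factor √(1 + r) leaves room for a logarithm at infinity. -/
theorem div_le_radialBound {r : ℝ} (hr : 0 ≤ r) :
    (r * (1 + r) ^ 2)⁻¹ * √(1 + r) ≤ radialBound r := by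
  rcases hr.eq_or_lt with rfl | hr
  · simp [radialBound]
  have h1 : 0 < √r := Real.sqrt_pos.2 hr
  have h2 : √(1 + r) * √r ≤ 1 + r := by
    calc √(1 + r) * √r ≤ √(1 + r) * √(1 + r) := by gcongr; linarith
      _ = 1 + r := Real.mul_self_sqrt (by linarith)
  unfold radialBound
  rw [inv_mul_eq_div, inv_eq_one_div, div_le_div_iff₀ (by positivity) (by positivity)]
  calc √(1 + r) * (r * √r * (1 + r)) = (√(1 + r) * √r) * (r * (1 + r)) := by ring
    _ ≤ (1 + r) * (r * (1 + r)) := by gcongr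
    _ = 1 * (r * (1 + r) ^ 2) := by ring

theorem log_le_two_mul_sqrt {x : ℝ} (hx : 0 < x) : Real.log x ≤ 2 * √x := by
  have h := Real.log_le_sub_one_of_pos (Real.sqrt_pos.2 hx)
  rw [Real.log_sqrt hx.le] at h
  linarith

theorem integrable_logJac₀ : Integrable logJac₀ := by
  refine Integrable.mono' (integrable_twoPointBound.const_mul 25)
    measurable_logJac₀.aestronglyMeasurable (.of_forall fun w => ?_)
  obtain ⟨r, hr, h1, -, h2⟩ := exists_abs_logJac₀_le w
  refine h2.trans ?_
  rw [div_eq_mul_inv]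
  refine mul_le_mul_of_nonneg_left (le_trans ?_ h1) (by norm_num)
  refine le_trans ?_ (div_le_radialBound hr)
  exact le_mul_of_one_le_right (by positivity) (Real.one_le_sqrt.2 (by linarith))

theorem integrable_log_mul_logJac₀ :
    Integrable fun w : ℂ => Real.log (1 + ‖w‖) * |logJac₀ w| := by
  refine Integrable.mono' (integrable_twoPointBound.const_mul 100)
    (by fun_prop) (.of_forall fun w => ?_)
  obtain ⟨r, hr, h1, h0, h2⟩ := exists_abs_logJac₀_le w
  have h3 : Real.log (1 + ‖w‖) ≤ 4 * √(1 + r) := by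
    refine (log_le_two_mul_sqrt (by positivity)).trans ?_
    have : √(1 + ‖w‖) ≤ 2 * √(1 + r) := by
      rw [Real.sqrt_le_left (by positivity), mul_pow, Real.sq_sqrt (by positivity)]
      linarith
    linarith
  have h4 : 0 ≤ Real.log (1 + ‖w‖) := Real.log_nonneg (by linarith [norm_nonneg w])
  rw [Real.norm_of_nonneg (by positivity)]
  calc Real.log (1 + ‖w‖) * |logJac₀ w| ≤ (4 * √(1 + r)) * (25 / (r * (1 + r) ^ 2)) := by gcongr
    _ = 100 * ((r * (1 + r) ^ 2)⁻¹ * √(1 + r)) := by ring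
    _ ≤ 100 * twoPointBound w := by gcongr; exact (div_le_radialBound hr).trans h1

/-- This is membership in L^(3/2): the singularities become r^(-3/2), still integrable in the plane.
The exponent is conjugate to the cube of the logarithm in `abs_log_mul_le`. -/
theorem integrable_logJac₀_mul_sqrt :
    Integrable fun w : ℂ => |logJac₀ w| * √|logJac₀ w| := by
  refine Integrable.mono' (integrable_twoPointBound.const_mul 125)
    (by fun_prop) (.of_forall fun w => ?_)
  obtain ⟨r, hr, h1, h0, h2⟩ := exists_abs_logJac₀_le w
  rw [Real.norm_of_nonneg (by positivity)]
  have h3 : √|logJac₀ w| ≤ 5 / (√r * (1 + r)) := by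
    rw [Real.sqrt_le_left (by positivity), div_pow, mul_pow, Real.sq_sqrt hr]
    norm_num [h2]
  calc |logJac₀ w| * √|logJac₀ w| ≤ (25 / (r * (1 + r) ^ 2)) * (5 / (√r * (1 + r))) := by gcongr
    _ = 125 * (radialBound r * ((1 + r) ^ 2)⁻¹) := by
      unfold radialBound
      simp only [div_eq_mul_inv, mul_inv]
      ring
    _ ≤ 125 * twoPointBound w := by
      gcongr
      refine le_trans (mul_le_of_le_one_right (radialBound_nonneg hr) ?_) h1
      exact inv_le_one_of_one_le₀ (by nlinarith)

/-- A Young inequality with exponents 3 and 3/2 separates the logarithmic singularity from b when u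
< 1; for u ≥ 1 the term log(1 + u) suffices. -/
theorem abs_log_mul_le {u b : ℝ} (hu : 0 ≤ u) (hb : 0 ≤ b) :
    |Real.log u| * b ≤ 16 * radialBound u + b * √b + Real.log (1 + u) * b := by
  have h0 := radialBound_nonneg hu
  have hl : 0 ≤ Real.log (1 + u) := Real.log_nonneg (by linarith)
  rcases hu.eq_or_lt with rfl | hu
  · simp only [Real.log_zero, abs_zero, zero_mul]; positivity
  rcases le_or_gt 1 u with h1 | h1
  · rw [abs_of_nonneg (Real.log_nonneg h1)]
    have : Real.log u ≤ Real.log (1 + u) := Real.log_le_log hu (by linarith)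
    have h2 : Real.log u * b ≤ Real.log (1 + u) * b := by gcongr
    have : 0 ≤ b * √b := by positivity
    linarith
  · have hs : 0 < √u := Real.sqrt_pos.2 hu
    have ha : |Real.log u| ≤ 2 / √u := by
      rw [abs_of_neg (Real.log_neg hu h1), ← Real.log_inv]
      refine (log_le_two_mul_sqrt (by positivity)).trans ?_
      rw [Real.sqrt_inv, div_eq_mul_inv]
    have hk : |Real.log u| ^ 3 ≤ 16 * radialBound u := by
      calc |Real.log u| ^ 3 ≤ (2 / √u) ^ 3 := by gcongr
        _ = 8 / (u * √u) := by
          rw [div_pow, pow_succ √u, Real.sq_sqrt hu.le]; norm_num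
        _ ≤ 16 * radialBound u := by
          unfold radialBound
          rw [← div_eq_mul_inv, div_le_div_iff₀ (by positivity) (by positivity)]
          have : 0 < u * √u := by positivity
          nlinarith
    have h3 : |Real.log u| * b ≤ |Real.log u| ^ 3 + b * √b := by
      -- Young's inequality without constants: compare b with the square of the logarithm.
      rcases le_or_gt b (|Real.log u| ^ 2) with h | h
      · calc |Real.log u| * b ≤ |Real.log u| * |Real.log u| ^ 2 := by gcongr
          _ = |Real.log u| ^ 3 := by ring
          _ ≤ _ := le_add_of_nonneg_right (by positivity)
      · have : |Real.log u| ≤ √b := Real.le_sqrt_of_sq_le h.le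
        calc |Real.log u| * b ≤ √b * b := by gcongr
          _ = b * √b := mul_comm _ _
          _ ≤ _ := le_add_of_nonneg_left (by positivity)
    have : 0 ≤ Real.log (1 + u) * b := by positivity
    linarith

/-- After `abs_log_mul_le`, the singular part is a convolution integrand of L¹ functions, and log(1
+ |z - w|) ≤ log(1 + |z|) + log(1 + |w|) reduces the rest to products. -/
theorem integrable_mainTerm : Integrable mainTerm := by
  have hg := integrable_logJac₀.abs
  have i1 : Integrable fun x : ℂ × ℂ => |logJac₀ x.2| * radialBound ‖x.1 - x.2‖ :=
    hg.convolution_integrand (ContinuousLinearMap.mul ℝ ℝ) integrable_radialBound_norm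
  have i2 : Integrable fun x : ℂ × ℂ => |logJac₀ x.1| * √|logJac₀ x.1| * |logJac₀ x.2| :=
    integrable_logJac₀_mul_sqrt.mul_prod hg
  have i3 : Integrable fun x : ℂ × ℂ => Real.log (1 + ‖x.1‖) * |logJac₀ x.1| * |logJac₀ x.2| :=
    integrable_log_mul_logJac₀.mul_prod hg
  have i4 : Integrable fun x : ℂ × ℂ => |logJac₀ x.1| * (Real.log (1 + ‖x.2‖) * |logJac₀ x.2|) :=
    hg.mul_prod integrable_log_mul_logJac₀
  refine Integrable.mono' ((((i1.const_mul 16).add i2).add i3).add i4)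
    (by unfold mainTerm; fun_prop) (.of_forall fun x => ?_)
  simp only [Pi.add_apply, mainTerm, norm_mul, Real.norm_eq_abs]
  have h1 := abs_log_mul_le (norm_nonneg (x.1 - x.2)) (abs_nonneg (logJac₀ x.1))
  have h2 : Real.log (1 + ‖x.1 - x.2‖) ≤ Real.log (1 + ‖x.1‖) + Real.log (1 + ‖x.2‖) := by
    rw [← Real.log_mul (by positivity) (by positivity)]
    refine Real.log_le_log (by positivity) ?_
    nlinarith [norm_sub_le x.1 x.2, norm_nonneg x.1, norm_nonneg x.2]
  have h3 := mul_le_mul_of_nonneg_right h2 (abs_nonneg (logJac₀ x.1))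
  have h4 := mul_le_mul_of_nonneg_right (h1.trans (add_le_add_right h3 _))
    (abs_nonneg (logJac₀ x.2))
  linarith

theorem integrable_log_norm_mul_logJac₀ : Integrable fun w : ℂ => Real.log ‖w‖ * logJac₀ w := by
  refine Integrable.mono' (((integrable_radialBound_norm.const_mul 16).add
    integrable_logJac₀_mul_sqrt).add integrable_log_mul_logJac₀)
    (by fun_prop) (.of_forall fun w => ?_)
  simpa only [Pi.add_apply, norm_mul, Real.norm_eq_abs] using
    abs_log_mul_le (norm_nonneg w) (abs_nonneg (logJac₀ w))

/-! ### The projective substitution turning side terms into the main term -/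

theorem integral_logJac₀ : ∫ w, logJac₀ w = 0 := by
  have h : ∀ w, logJac₀ (Complex.conjLIE w) = -logJac₀ w := fun w => by
    simp [logJac₀, logJac, Complex.normSq_apply]
    ring
  have := Complex.conjLIE.measurePreserving.integral_comp
    Complex.conjLIE.toHomeomorph.measurableEmbedding logJac₀
  simp only [h, integral_neg] at this
  linarith

/-- The projective change of coordinates exchanging the roles of two edges of the tetrahedron. -/
noncomputable def edgeSwap (x : ℂ × ℂ) : ℂ × ℂ := (1 - x.1 / x.2, 1 - 1 / x.2)

/-- The complex derivative of `edgeSwap`. -/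
noncomputable def edgeSwapDeriv (x : ℂ × ℂ) : ℂ × ℂ →L[ℂ] ℂ × ℂ :=
  (Matrix.toLin (.finTwoProd ℂ) (.finTwoProd ℂ)
    !![-x.2⁻¹, x.1 / x.2 ^ 2; 0, (x.2 ^ 2)⁻¹]).toContinuousLinearMap

theorem hasFDerivAt_edgeSwap {x : ℂ × ℂ} (hx : x.2 ≠ 0) :
    HasFDerivAt edgeSwap (edgeSwapDeriv x) x := by
  unfold edgeSwapDeriv
  rw [Matrix.toLin_finTwoProd_toContinuousLinearMap]
  have h1 : HasFDerivAt (fun y : ℂ × ℂ => y.2⁻¹)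
      (-(x.2 ^ 2)⁻¹ • ContinuousLinearMap.snd ℂ ℂ ℂ) x :=
    (hasDerivAt_inv hx).comp_hasFDerivAt x hasFDerivAt_snd
  have h2 := ((hasFDerivAt_fst (𝕜 := ℂ) (p := x)).mul h1).const_sub 1
  have h3 := h1.const_sub 1
  convert! h2.prodMk h3 using 1
  · funext y; simp [edgeSwap, div_eq_mul_inv]
  · ext <;> simp [div_eq_mul_inv]

/-- The real Jacobian of a holomorphic map is the squared modulus of the complex one, here -w⁻³. -/
theorem det_edgeSwapDeriv (x : ℂ × ℂ) :
    |((edgeSwapDeriv x).restrictScalars ℝ).det| = (Complex.normSq x.2)⁻¹ ^ 3 := by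
  have h : ((edgeSwapDeriv x).restrictScalars ℝ).det =
      Complex.normSq (-x.2⁻¹ * (x.2 ^ 2)⁻¹) := by
    rw [ContinuousLinearMap.det, ContinuousLinearMap.coe_restrictScalars,
      LinearMap.det_restrictScalars, Algebra.norm_complex_apply, edgeSwapDeriv,
      LinearMap.coe_toContinuousLinearMap, LinearMap.det_toLin, Matrix.det_fin_two_of]
    simp
  rw [h, abs_of_nonneg (Complex.normSq_nonneg _)]
  simp
  ring

theorem injOn_edgeSwap : Set.InjOn edgeSwap {x | x.2 ≠ 0} := by
  rintro ⟨a, b⟩ hx ⟨c, d⟩ hy h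
  simp only [Set.mem_ofPred_eq, edgeSwap, Prod.mk.injEq, sub_right_inj, one_div, inv_inj]
    at hx hy h
  obtain ⟨h1, rfl⟩ := h
  rw [div_left_inj' hx] at h1
  rw [h1]

theorem image_edgeSwap : edgeSwap '' {x | x.2 ≠ 0} = {x | x.2 ≠ 1} := by
  ext ⟨z, w⟩
  simp only [Set.mem_image, Set.mem_ofPred_eq, edgeSwap, Prod.exists, Prod.mk.injEq]
  constructor
  · rintro ⟨a, b, hb, -, rfl⟩
    simpa using hb
  · intro hw
    have : 1 - w ≠ 0 := sub_ne_zero.2 (Ne.symm hw)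
    refine ⟨(1 - z) / (1 - w), 1 / (1 - w), by simpa using this, ?_, ?_⟩ <;> field_simp <;> ring

theorem ae_snd_ne (c : ℂ) : ∀ᵐ x : ℂ × ℂ, x.2 ≠ c :=
  Measure.quasiMeasurePreserving_snd.ae (Measure.ae_ne volume c)

theorem ae_fst_ne (c : ℂ) : ∀ᵐ x : ℂ × ℂ, x.1 ≠ c :=
  Measure.quasiMeasurePreserving_fst.ae (Measure.ae_ne volume c)

theorem ae_fst_ne_snd : ∀ᵐ x : ℂ × ℂ, x.1 ≠ x.2 := by
  have h : MeasurableSet {x : ℂ × ℂ | x.1 ≠ x.2} :=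
    (measurableSet_eq_fun measurable_fst measurable_snd).compl
  rw [Measure.volume_eq_prod, Measure.ae_prod_iff_ae_ae h]
  exact .of_forall fun z => (Measure.ae_ne volume z).mono fun w hw => hw.symm

theorem logJac_mul (c a b : ℂ) : logJac (c * a) (c * b) = logJac a b / Complex.normSq c := by
  rcases eq_or_ne c 0 with rfl | hc
  · simp [logJac]
  have hc' : Complex.normSq c ≠ 0 := by simpa using hc
  have : (c * a).re * (c * b).im - (c * a).im * (c * b).re =
      Complex.normSq c * (a.re * b.im - a.im * b.re) := by
    simp [Complex.normSq_apply]; ring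
  rw [logJac, logJac, this, Complex.normSq_mul, Complex.normSq_mul, div_div,
    show Complex.normSq c * Complex.normSq a * (Complex.normSq c * Complex.normSq b) =
      Complex.normSq c * ((Complex.normSq a * Complex.normSq b) * Complex.normSq c) by ring,
    mul_div_mul_left _ _ hc']

/-- With (z', w') the image, z' - 1 = -z/w, z' - w' = -(z - 1)/w and z' = -(z - w)/w. The powers of
|w| cancel against the Jacobian, and log|z'| = log|z - w| - log|w| produces the product correction.
-/
theorem sideTerm_edgeSwap {x : ℂ × ℂ} (h0 : x.2 ≠ 0) (h1 : x.1 ≠ x.2) :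
    (Complex.normSq x.2)⁻¹ ^ 3 * sideTerm (edgeSwap x) =
      mainTerm x - logJac₀ x.1 * (Real.log ‖x.2‖ * logJac₀ x.2) := by
  obtain ⟨z, w⟩ := x
  simp only at h0 h1
  have hw : Complex.normSq w ≠ 0 := by simpa using h0
  have e1 : 1 - z / w - 1 = -w⁻¹ * z := by field_simp; ring
  have e2 : 1 - z / w - (1 - 1 / w) = -w⁻¹ * (z - 1) := by field_simp; ring
  have e3 : 1 - z / w = (z - w) * (-w⁻¹) := by field_simp; ring
  have e4 : logJac₀ (1 - 1 / w) = logJac₀ w * Complex.normSq w ^ 2 := by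
    have a1 : 1 - 1 / w = w⁻¹ * (w - 1) := by field_simp
    have a2 : 1 - 1 / w - 1 = w⁻¹ * (-1) := by field_simp; ring
    have a3 : (w - 1).re * (-1 : ℂ).im - (w - 1).im * (-1 : ℂ).re = w.im := by simp
    have a4 : w.re * (w - 1).im - w.im * (w - 1).re = w.im := by simp; ring
    have a5 : Complex.normSq (-1) = 1 := by simp
    rw [logJac₀, logJac₀, a2, a1, logJac_mul, logJac, logJac, a3, a4, a5, map_inv₀]
    field_simp
  simp only [edgeSwap, sideTerm, mainTerm]
  rw [e2, e4, e1, logJac_mul, e3, norm_mul, Real.log_mul (by simpa [sub_eq_zero] using h1)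
    (by simpa using h0)]
  simp only [norm_neg, norm_inv, Real.log_inv, map_inv₀, Complex.normSq_neg]
  rw [show logJac z (z - 1) = logJac₀ z from rfl]
  field_simp
  ring

instance isAddHaarMeasure_volume_complex_prod :
    Measure.IsAddHaarMeasure (volume : Measure (ℂ × ℂ)) :=
  Measure.prod.instIsAddHaarMeasure _ _

theorem integrable_sideTerm_and_integral :
    Integrable sideTerm ∧ ∫ x, sideTerm x = ∫ x, mainTerm x := by
  have hm : MeasurableSet {x : ℂ × ℂ | x.2 ≠ 0} :=
    (measurableSet_eq_fun measurable_snd measurable_const).compl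
  have hd : ∀ x ∈ {x : ℂ × ℂ | x.2 ≠ 0}, HasFDerivWithinAt edgeSwap
      ((edgeSwapDeriv x).restrictScalars ℝ) {x | x.2 ≠ 0} x := fun x hx =>
    ((hasFDerivAt_edgeSwap hx).restrictScalars ℝ).hasFDerivWithinAt
  have r0 : volume.restrict {x : ℂ × ℂ | x.2 ≠ 0} = volume :=
    Measure.restrict_eq_self_of_ae_mem (ae_snd_ne 0)
  have r1 : volume.restrict {x : ℂ × ℂ | x.2 ≠ 1} = volume :=
    Measure.restrict_eq_self_of_ae_mem (ae_snd_ne 1)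
  have hae : (fun x => |((edgeSwapDeriv x).restrictScalars ℝ).det| • sideTerm (edgeSwap x))
      =ᵐ[volume] fun x => mainTerm x - logJac₀ x.1 * (Real.log ‖x.2‖ * logJac₀ x.2) := by
    filter_upwards [ae_snd_ne 0, ae_fst_ne_snd] with x h0 h1
    rw [det_edgeSwapDeriv, smul_eq_mul, sideTerm_edgeSwap h0 h1]
  have hp := integrable_logJac₀.mul_prod integrable_log_norm_mul_logJac₀
  constructor
  · have h := integrableOn_image_iff_integrableOn_abs_det_fderiv_smul volume hm hd
      injOn_edgeSwap sideTerm
    rw [image_edgeSwap, IntegrableOn, IntegrableOn, r0, r1, integrable_congr hae] at h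
    exact h.2 (integrable_mainTerm.sub hp)
  · have h := integral_image_eq_integral_abs_det_fderiv_smul volume hm hd
      injOn_edgeSwap sideTerm
    rw [image_edgeSwap, r0, r1, integral_congr_ae hae, integral_sub integrable_mainTerm hp] at h
    have h0 : ∫ x : ℂ × ℂ, logJac₀ x.1 * (Real.log ‖x.2‖ * logJac₀ x.2) = 0 := by
      rw [Measure.volume_eq_prod, integral_prod_mul logJac₀ fun w => Real.log ‖w‖ * logJac₀ w,
        integral_logJac₀, zero_mul]
    rw [h, h0, sub_zero]

/-! ### Reduction of the weight to the main term -/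

/-- The point reflection x ↦ (1, 1) - x and the swap of coordinates preserve volume, so all four
side terms have the same integral as the main one. -/
theorem integrable_det_and_integral :
    Integrable (fun x : ℂ × ℂ => (Matrix.of fun e =>
      logRow ![0, 1, x.1, x.2] sectFrame (lexEdge e).1 (lexEdge e).2).det) ∧
    ∫ x : ℂ × ℂ, (Matrix.of fun e =>
      logRow ![0, 1, x.1, x.2] sectFrame (lexEdge e).1 (lexEdge e).2).det =
        -5 * ∫ x, mainTerm x := by
  obtain ⟨h, hi⟩ := integrable_sideTerm_and_integral
  have mr : MeasurePreserving (fun x : ℂ × ℂ => (1, 1) - x) :=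
    Measure.measurePreserving_sub_left volume _
  have ms : MeasurePreserving (Prod.swap : ℂ × ℂ → ℂ × ℂ) := Measure.measurePreserving_swap
  have er : MeasurableEmbedding (fun x : ℂ × ℂ => (1, 1) - x) :=
    (MeasurableEquiv.subLeft ((1, 1) : ℂ × ℂ)).measurableEmbedding
  have es : MeasurableEmbedding (Prod.swap : ℂ × ℂ → ℂ × ℂ) :=
    MeasurableEquiv.prodComm.measurableEmbedding
  have h2 : Integrable fun x => sideTerm ((1, 1) - x) := (mr.integrable_comp_emb er).2 h
  have h3 : Integrable fun x : ℂ × ℂ => sideTerm x.swap := (ms.integrable_comp_emb es).2 h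
  have h4 : Integrable fun x : ℂ × ℂ => sideTerm ((1, 1) - x).swap := (mr.integrable_comp_emb er).2 h3
  have i2 := mr.integral_comp er sideTerm
  have i3 := ms.integral_comp es sideTerm
  have i4 := mr.integral_comp er fun x => sideTerm x.swap
  have hsum : ∀ x : ℂ × ℂ, (Matrix.of fun e =>
      logRow ![0, 1, x.1, x.2] sectFrame (lexEdge e).1 (lexEdge e).2).det =
      -(mainTerm x + sideTerm x + sideTerm ((1, 1) - x) + sideTerm x.swap +
        sideTerm ((1, 1) - x).swap) := fun x => det_logRow_lexEdge x.1 x.2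
  simp only [hsum]
  have s1 : Integrable fun x : ℂ × ℂ => mainTerm x + sideTerm x := integrable_mainTerm.add h
  have s2 : Integrable fun x : ℂ × ℂ => mainTerm x + sideTerm x + sideTerm ((1, 1) - x) := s1.add h2
  have s3 : Integrable fun x : ℂ × ℂ => mainTerm x + sideTerm x + sideTerm ((1, 1) - x) +
      sideTerm x.swap := s2.add h3
  refine ⟨(s3.add h4).neg, ?_⟩
  rw [integral_neg, integral_add s3 h4, integral_add s2 h3, integral_add s1 h2,
    integral_add integrable_mainTerm h]
  rw [i2, i3, i4, i3, hi]
  ring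

theorem volume_restrict_confQuot : volume.restrict (ConfQuot 2) = volume := by
  refine Measure.restrict_eq_self_of_ae_mem ?_
  have h : ∀ᵐ x : ℂ × ℂ, (x.1 ≠ 0 ∧ x.1 ≠ 1) ∧ (x.2 ≠ 0 ∧ x.2 ≠ 1) ∧ x.1 ≠ x.2 := by
    filter_upwards [ae_fst_ne 0, ae_fst_ne 1, ae_snd_ne 0, ae_snd_ne 1, ae_fst_ne_snd]
      with x a b c d e using ⟨⟨a, b⟩, ⟨c, d⟩, e⟩
  have := (volume_preserving_finTwoArrow ℂ).quasiMeasurePreserving.ae h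
  filter_upwards [this] with z hz
  obtain ⟨⟨a, b⟩, ⟨c, d⟩, e⟩ := hz
  simp only [MeasurableEquiv.finTwoArrow_apply] at a b c d e
  have h1 : sect z = ![0, 1, z 0, z 1] := by
    funext i; fin_cases i <;> rfl
  change Function.Injective (sect z)
  rw [h1]
  intro i j hij
  fin_cases i <;> fin_cases j <;> simp_all [eq_comm]

theorem integrableOn_weightDensity_and_weight {Γ : DirGraph 4 6} (hΓ : Γ.IsTetrahedron) :
    IntegrableOn (weightDensity (m := 2) (1 / 2) Γ) (ConfQuot 2) ∧ ∃ s : ℤˣ,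
      weight (m := 2) (1 / 2) Γ = ((s : ℤ) : ℂ) *
        (1 / ((Real.pi : ℂ) * Complex.I) * (1 / (2 * (Real.pi : ℂ) * Complex.I)) ^ 4) *
          ((5 * ∫ x, mainTerm x : ℝ) : ℂ) := by
  obtain ⟨s, hs⟩ := det_logRow_of_isTetrahedron hΓ
  obtain ⟨h, hi⟩ := integrable_det_and_integral
  set D : ℂ × ℂ → ℝ := fun x => (Matrix.of fun e =>
      logRow ![0, 1, x.1, x.2] sectFrame (lexEdge e).1 (lexEdge e).2).det with hD
  set C : ℂ := 1 / ((Real.pi : ℂ) * Complex.I) * (1 / (2 * (Real.pi : ℂ) * Complex.I)) ^ 4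
  have key : weightDensity (m := 2) (1 / 2) Γ =
      (fun x => (((s : ℤ) : ℂ) * C) * ((D x : ℝ) : ℂ)) ∘ MeasurableEquiv.finTwoArrow := by
    funext z
    rw [weightDensity_half, hs]
    simp only [Function.comp, MeasurableEquiv.finTwoArrow_apply, hD, C]
    push_cast
    ring
  have mp := volume_preserving_finTwoArrow ℂ
  have em : MeasurableEmbedding (MeasurableEquiv.finTwoArrow : (Fin 2 → ℂ) ≃ᵐ ℂ × ℂ) :=
    MeasurableEquiv.finTwoArrow.measurableEmbedding
  constructor
  · rw [IntegrableOn, volume_restrict_confQuot, key, mp.integrable_comp_emb em]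
    exact h.ofReal.const_mul _
  · refine ⟨-s, ?_⟩
    rw [weight, volume_restrict_confQuot, key]
    have := mp.integral_comp em (fun x => (((s : ℤ) : ℂ) * C) * ((D x : ℝ) : ℂ))
    simp only [Function.comp_def]
    rw [this, integral_const_mul, integral_complex_ofReal, hi]
    push_cast
    ring

/-! ### Logarithmic polar coordinates -/

/-- The logarithmic polar coordinate map. -/
noncomputable def logPolar (x θ : ℝ) : ℂ := Complex.exp (x + θ * Complex.I)

theorem ae_mem_slitPlane : ∀ᵐ z : ℂ, z ∈ Complex.slitPlane := by
  have h : ∀ᵐ x : ℝ × ℝ, x.2 ≠ 0 :=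
    Measure.quasiMeasurePreserving_snd.ae (Measure.ae_ne volume 0)
  filter_upwards [Complex.volume_preserving_equiv_real_prod.quasiMeasurePreserving.ae h] with z hz
  exact Or.inr hz

/-- The exponential maps the strip |Im ζ| < π bijectively onto the slit plane, which has full
measure, with real Jacobian |exp ζ|². -/
theorem integrable_logPolar_and_integral {f : ℂ → ℝ} (hf : Integrable f) :
    Integrable (fun p : ℝ × ℝ => Real.exp (2 * p.1) * f (logPolar p.1 p.2))
      (volume.prod (volume.restrict (Set.Ioo (-Real.pi) Real.pi))) ∧
    ∫ z, f z = ∫ x : ℝ, ∫ θ in Set.Ioo (-Real.pi) Real.pi,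
      Real.exp (2 * x) * f (logPolar x θ) := by
  set S : Set ℂ := Complex.im ⁻¹' Set.Ioo (-Real.pi) Real.pi with hS
  have hSm : MeasurableSet S := Complex.measurable_im measurableSet_Ioo
  have himg : Complex.exp '' S = Complex.slitPlane :=
    Complex.expOpenPartialHomeomorph.image_source_eq_target
  have hinj : Set.InjOn Complex.exp S := Complex.expOpenPartialHomeomorph.injOn
  have hd : ∀ ζ ∈ S, HasFDerivWithinAt Complex.exp
      ((ContinuousLinearMap.toSpanSingleton ℂ (Complex.exp ζ)).restrictScalars ℝ) S ζ :=
    fun ζ _ => ((Complex.hasDerivAt_exp ζ).hasFDerivAt.restrictScalars ℝ).hasFDerivWithinAt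
  have hdet : ∀ ζ : ℂ, |((ContinuousLinearMap.toSpanSingleton ℂ
      (Complex.exp ζ)).restrictScalars ℝ).det| = Real.exp (2 * ζ.re) := fun ζ => by
    rw [ContinuousLinearMap.det, ContinuousLinearMap.coe_restrictScalars,
      LinearMap.det_restrictScalars, Algebra.norm_complex_apply]
    simp [Complex.normSq_eq_norm_sq, Complex.norm_exp, ← Real.exp_nat_mul]
  have r : volume.restrict Complex.slitPlane = volume :=
    Measure.restrict_eq_self_of_ae_mem ae_mem_slitPlane
  have hpre : S = Complex.measurableEquivRealProd ⁻¹'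
      (Set.univ ×ˢ Set.Ioo (-Real.pi) Real.pi) := by
    ext z; simp [hS, Complex.measurableEquivRealProd_apply]
  have mp : MeasurePreserving Complex.measurableEquivRealProd (volume.restrict S)
      (volume.prod (volume.restrict (Set.Ioo (-Real.pi) Real.pi))) := by
    have := Complex.volume_preserving_equiv_real_prod.restrict_preimage
      (MeasurableSet.univ.prod (measurableSet_Ioo (a := -Real.pi) (b := Real.pi)))
    rwa [← hpre, Measure.volume_eq_prod, ← Measure.prod_restrict, Measure.restrict_univ] at this
  have em := Complex.measurableEquivRealProd.measurableEmbedding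
  have hcomp : (fun p : ℝ × ℝ => Real.exp (2 * p.1) * f (logPolar p.1 p.2)) ∘
      Complex.measurableEquivRealProd = fun ζ => |((ContinuousLinearMap.toSpanSingleton ℂ
      (Complex.exp ζ)).restrictScalars ℝ).det| • f (Complex.exp ζ) := by
    funext ζ
    simp only [hdet, Function.comp, Complex.measurableEquivRealProd_apply, logPolar,
      Complex.re_add_im, smul_eq_mul]
  have hint : Integrable (fun p : ℝ × ℝ => Real.exp (2 * p.1) * f (logPolar p.1 p.2))
      (volume.prod (volume.restrict (Set.Ioo (-Real.pi) Real.pi))) := by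
    rw [← mp.integrable_comp_emb em, hcomp]
    have h := integrableOn_image_iff_integrableOn_abs_det_fderiv_smul volume hSm hd hinj f
    rw [himg, IntegrableOn, r] at h
    exact h.1 hf
  refine ⟨hint, ?_⟩
  have h := integral_image_eq_integral_abs_det_fderiv_smul volume hSm hd hinj f
  rw [himg, r, ← hcomp] at h
  simp only [Function.comp_def] at h
  rw [h, mp.integral_comp em (fun p : ℝ × ℝ => Real.exp (2 * p.1) * f (logPolar p.1 p.2)),
    integral_prod _ hint]

/-! ### Trigonometric series on the circle and Parseval's formula -/

section Fourier

theorem integral_sin_nat_mul (n : ℕ) :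
    ∫ θ in Set.Ioo (-Real.pi) Real.pi, Real.sin (((n : ℝ) + 1) * θ) = 0 := by
  rw [← integral_Ioc_eq_integral_Ioo,
    ← intervalIntegral.integral_of_le (by linarith [Real.pi_pos]),
    intervalIntegral.integral_comp_mul_left _ (by positivity)]
  simp

theorem integral_cos_int_mul (k : ℤ) :
    ∫ θ in Set.Ioo (-Real.pi) Real.pi, Real.cos ((k : ℝ) * θ) =
      if k = 0 then 2 * Real.pi else 0 := by
  rw [← integral_Ioc_eq_integral_Ioo,
    ← intervalIntegral.integral_of_le (by linarith [Real.pi_pos])]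
  split_ifs with h
  · simp [h]; ring
  · rw [intervalIntegral.integral_comp_mul_left _ (by exact_mod_cast h)]
    simp [Real.sin_int_mul_pi]

theorem integral_sin_mul_sin_nat (n m : ℕ) :
    ∫ θ in Set.Ioo (-Real.pi) Real.pi,
      Real.sin (((n : ℝ) + 1) * θ) * Real.sin (((m : ℝ) + 1) * θ) =
      if n = m then Real.pi else 0 := by
  have h : ∀ θ : ℝ, Real.sin (((n : ℝ) + 1) * θ) * Real.sin (((m : ℝ) + 1) * θ) =
      2⁻¹ * (Real.cos (((n - m : ℤ) : ℝ) * θ) - Real.cos (((n + m + 2 : ℤ) : ℝ) * θ)) := fun θ => by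
    push_cast
    rw [show ((n : ℝ) - m) * θ = (n + 1) * θ - (m + 1) * θ by ring,
      show ((n : ℝ) + m + 2) * θ = (n + 1) * θ + (m + 1) * θ by ring, Real.cos_sub, Real.cos_add]
    ring
  have hi : ∀ k : ℤ, IntegrableOn (fun θ : ℝ => Real.cos ((k : ℝ) * θ))
      (Set.Ioo (-Real.pi) Real.pi) := fun k =>
    (Continuous.integrableOn_Icc (by fun_prop)).mono_set Set.Ioo_subset_Icc_self
  simp only [h]
  rw [integral_const_mul, integral_sub (hi _) (hi _), integral_cos_int_mul, integral_cos_int_mul,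
    if_neg (show (n + m + 2 : ℤ) ≠ 0 by omega)]
  simp only [sub_eq_zero, Nat.cast_inj]
  split_ifs <;> ring

theorem integral_cos_mul_sin_nat (n m : ℕ) :
    ∫ θ in Set.Ioo (-Real.pi) Real.pi,
      Real.cos (((n : ℝ) + 1) * θ) * Real.sin (((m : ℝ) + 1) * θ) = 0 := by
  rw [← integral_Ioc_eq_integral_Ioo,
    ← intervalIntegral.integral_of_le (by linarith [Real.pi_pos])]
  have h := intervalIntegral.integral_comp_neg (a := -Real.pi) (b := Real.pi)
    fun θ => Real.cos (((n : ℝ) + 1) * θ) * Real.sin (((m : ℝ) + 1) * θ)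
  simp only [mul_neg, Real.cos_neg, Real.sin_neg, neg_neg, intervalIntegral.integral_neg] at h
  linarith

theorem measurable_of_hasSum_trig {a b : ℕ → ℝ} (a₀ : ℝ) {f : ℝ → ℝ}
    (hf : ∀ θ, HasSum (fun n : ℕ => a n * Real.cos (((n : ℝ) + 1) * θ) +
      b n * Real.sin (((n : ℝ) + 1) * θ)) (f θ - a₀)) : Measurable f := by
  have : f = fun θ => a₀ + ∑' n : ℕ, (a n * Real.cos (((n : ℝ) + 1) * θ) +
      b n * Real.sin (((n : ℝ) + 1) * θ)) := by
    funext θ; rw [(hf θ).tsum_eq]; ring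
  rw [this]
  refine measurable_const.add (measurable_of_tendsto_metrizable
    (f := fun N θ => ∑ n ∈ Finset.range N, (a n * Real.cos (((n : ℝ) + 1) * θ) +
      b n * Real.sin (((n : ℝ) + 1) * θ))) (fun N => by fun_prop) ?_)
  rw [tendsto_pi_nhds]
  exact fun θ => (hf θ).summable.hasSum.tendsto_sum_nat

theorem abs_le_of_hasSum_trig {a b : ℕ → ℝ} (a₀ : ℝ) (ha : Summable fun n => |a n|)
    (hb : Summable fun n => |b n|) {f : ℝ → ℝ}
    (hf : ∀ θ, HasSum (fun n : ℕ => a n * Real.cos (((n : ℝ) + 1) * θ) +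
      b n * Real.sin (((n : ℝ) + 1) * θ)) (f θ - a₀)) (θ : ℝ) :
    |f θ| ≤ |a₀| + ∑' n, (|a n| + |b n|) := by
  have : |f θ - a₀| ≤ ∑' n, (|a n| + |b n|) := by
    rw [← (hf θ).tsum_eq, ← Real.norm_eq_abs]
    refine tsum_of_norm_bounded (ha.add hb).hasSum fun n => ?_
    rw [Real.norm_eq_abs]
    refine (abs_add_le _ _).trans ?_
    rw [abs_mul, abs_mul]
    gcongr
    · exact mul_le_of_le_one_right (abs_nonneg _) (Real.abs_cos_le_one _)
    · exact mul_le_of_le_one_right (abs_nonneg _) (Real.abs_sin_le_one _)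
  have h3 := abs_add_le a₀ (f θ - a₀)
  rw [add_sub_cancel] at h3
  linarith

/-- Termwise integration of an absolutely convergent trigonometric series against a bounded
function. -/
theorem hasSum_integral_trig_mul {a b : ℕ → ℝ} (a₀ : ℝ) (ha : Summable fun n => |a n|)
    (hb : Summable fun n => |b n|) {f g : ℝ → ℝ} {C : ℝ} (hg : Measurable g)
    (hgC : ∀ θ, |g θ| ≤ C)
    (hf : ∀ θ, HasSum (fun n : ℕ => a n * Real.cos (((n : ℝ) + 1) * θ) +
      b n * Real.sin (((n : ℝ) + 1) * θ)) (f θ - a₀)) :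
    HasSum (fun n : ℕ => a n * (∫ θ in Set.Ioo (-Real.pi) Real.pi,
        Real.cos (((n : ℝ) + 1) * θ) * g θ) +
      b n * ∫ θ in Set.Ioo (-Real.pi) Real.pi, Real.sin (((n : ℝ) + 1) * θ) * g θ)
      ((∫ θ in Set.Ioo (-Real.pi) Real.pi, f θ * g θ) -
        a₀ * ∫ θ in Set.Ioo (-Real.pi) Real.pi, g θ) := by
  set μ := volume.restrict (Set.Ioo (-Real.pi) Real.pi) with hμ
  have hC : 0 ≤ C := (abs_nonneg _).trans (hgC 0)
  have bdd : ∀ {h : ℝ → ℝ} {D : ℝ}, Measurable h → (∀ θ, |h θ| ≤ D) → Integrable h μ :=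
    fun hm hD => Integrable.of_bound hm.aestronglyMeasurable _ (.of_forall hD)
  have ic : ∀ n : ℕ, Integrable (fun θ => Real.cos (((n : ℝ) + 1) * θ) * g θ) μ := fun n =>
    bdd (by fun_prop) (D := C) fun θ => by
      rw [abs_mul]
      exact (mul_le_of_le_one_left (abs_nonneg _) (Real.abs_cos_le_one _)).trans (hgC θ)
  have is : ∀ n : ℕ, Integrable (fun θ => Real.sin (((n : ℝ) + 1) * θ) * g θ) μ := fun n =>
    bdd (by fun_prop) (D := C) fun θ => by
      rw [abs_mul]
      exact (mul_le_of_le_one_left (abs_nonneg _) (Real.abs_sin_le_one _)).trans (hgC θ)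
  have ig : Integrable g μ := bdd hg hgC
  set F : ℕ → ℝ → ℝ := fun n θ => a n * (Real.cos (((n : ℝ) + 1) * θ) * g θ) +
      b n * (Real.sin (((n : ℝ) + 1) * θ) * g θ) with hF
  have iF : ∀ n, Integrable (F n) μ := fun n => ((ic n).const_mul _).add ((is n).const_mul _)
  have bF : ∀ n θ, ‖F n θ‖ ≤ (|a n| + |b n|) * C := fun n θ => by
    rw [Real.norm_eq_abs]
    refine (abs_add_le _ _).trans ?_
    rw [abs_mul, abs_mul, abs_mul, abs_mul, add_mul |a n|]
    have h1 := Real.abs_cos_le_one (((n : ℝ) + 1) * θ)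
    have h2 := Real.abs_sin_le_one (((n : ℝ) + 1) * θ)
    gcongr
    · exact (mul_le_of_le_one_left (abs_nonneg _) h1).trans (hgC θ)
    · exact (mul_le_of_le_one_left (abs_nonneg _) h2).trans (hgC θ)
  have sF : Summable fun n => ∫ θ, ‖F n θ‖ ∂μ := by
    refine Summable.of_nonneg_of_le (fun n => integral_nonneg fun θ => norm_nonneg _)
      (fun n => ?_) ((ha.add hb).mul_right (C * (2 * Real.pi)))
    calc ∫ θ, ‖F n θ‖ ∂μ ≤ ∫ θ, (|a n| + |b n|) * C ∂μ :=
          integral_mono (iF n).norm (integrable_const _) (bF n)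
      _ = (|a n| + |b n|) * (C * (2 * Real.pi)) := by
        rw [integral_const, smul_eq_mul, hμ, measureReal_restrict_apply_univ, Real.volume_real_Ioo]
        rw [max_eq_left (by linarith [Real.pi_pos])]
        ring
  have key := hasSum_integral_of_summable_integral_norm iF sF
  have h1 : ∀ θ, ∑' n, F n θ = f θ * g θ - a₀ * g θ := fun θ => by
    rw [← sub_mul, ← ((hf θ).mul_right (g θ)).tsum_eq]
    refine tsum_congr fun n => ?_
    simp only [hF]; ring
  have h2 : ∀ n, ∫ θ, F n θ ∂μ = a n * (∫ θ, Real.cos (((n : ℝ) + 1) * θ) * g θ ∂μ) +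
      b n * ∫ θ, Real.sin (((n : ℝ) + 1) * θ) * g θ ∂μ := fun n => by
    rw [integral_add ((ic n).const_mul _) ((is n).const_mul _), integral_const_mul,
      integral_const_mul]
  simp only [h1, h2] at key
  have ifg : Integrable (fun θ => f θ * g θ) μ := by
    refine bdd ((measurable_of_hasSum_trig a₀ hf).mul hg)
      (D := (|a₀| + ∑' n, (|a n| + |b n|)) * C) fun θ => ?_
    rw [abs_mul]
    exact mul_le_mul (abs_le_of_hasSum_trig a₀ ha hb hf θ) (hgC θ) (abs_nonneg _) (by positivity)
  rwa [integral_sub ifg (ig.const_mul _), integral_const_mul] at key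

theorem integral_trig_mul_sin {a b : ℕ → ℝ} (a₀ : ℝ) (ha : Summable fun n => |a n|)
    (hb : Summable fun n => |b n|) {f : ℝ → ℝ}
    (hf : ∀ θ, HasSum (fun n : ℕ => a n * Real.cos (((n : ℝ) + 1) * θ) +
      b n * Real.sin (((n : ℝ) + 1) * θ)) (f θ - a₀)) (m : ℕ) :
    ∫ θ in Set.Ioo (-Real.pi) Real.pi, f θ * Real.sin (((m : ℝ) + 1) * θ) = Real.pi * b m := by
  have h := hasSum_integral_trig_mul a₀ ha hb (g := fun θ => Real.sin (((m : ℝ) + 1) * θ))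
    (by fun_prop) (fun θ => Real.abs_sin_le_one _) hf
  simp only [integral_sin_nat_mul, integral_cos_mul_sin_nat, integral_sin_mul_sin_nat, mul_zero,
    sub_zero, zero_add, mul_ite] at h
  have h' := hasSum_ite_eq m (b m * Real.pi)
  rw [mul_comm Real.pi]
  refine h.unique ?_
  convert! h' using 2 with n
  split_ifs with h <;> simp [h]

/-- Parseval's formula for a trigonometric series and a sine series. -/
theorem hasSum_integral_mul_sineSeries {a b c : ℕ → ℝ} (a₀ : ℝ) (ha : Summable fun n => |a n|)
    (hb : Summable fun n => |b n|) (hc : Summable fun n => |c n|) {f g : ℝ → ℝ}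
    (hf : ∀ θ, HasSum (fun n : ℕ => a n * Real.cos (((n : ℝ) + 1) * θ) +
      b n * Real.sin (((n : ℝ) + 1) * θ)) (f θ - a₀))
    (hg : ∀ θ, HasSum (fun n : ℕ => c n * Real.sin (((n : ℝ) + 1) * θ)) (g θ)) :
    HasSum (fun n => Real.pi * (b n * c n))
      (∫ θ in Set.Ioo (-Real.pi) Real.pi, f θ * g θ) := by
  -- The sine series g is the one expanded; f only plays the bounded factor, and its own expansion
  -- enters through its sine coefficients.
  have h := hasSum_integral_trig_mul (a := 0) 0 (by simp) hc
    (measurable_of_hasSum_trig a₀ hf) (abs_le_of_hasSum_trig a₀ ha hb hf) (f := g)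
    (by simpa using hg)
  simp only [Pi.zero_apply, zero_mul, zero_add, sub_zero] at h
  convert! h using 2 with n
  · simp_rw [mul_comm (Real.sin _)]
    rw [integral_trig_mul_sin a₀ ha hb hf]
    ring
  · simp_rw [mul_comm]

end Fourier

/-! ### Fourier expansions of the kernel and of the density -/

theorem norm_exp_real_add_mul_I (x θ : ℝ) : ‖Complex.exp (x + θ * Complex.I)‖ = Real.exp x := by
  simp [Complex.norm_exp]

theorem summable_exp_neg_mul {c : ℝ} (hc : 0 < c) :
    Summable fun n : ℕ => Real.exp (-(((n : ℝ) + 1) * c)) := by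
  have h := (Real.summable_exp_nat_mul_iff (a := -c)).2 (by linarith)
  refine ((summable_nat_add_iff 1).2 h).congr fun n => ?_
  push_cast
  congr 1; ring

theorem pow_succ_exp (x θ : ℝ) (n : ℕ) : Complex.exp (x + θ * Complex.I) ^ (n + 1) =
    Complex.exp ((((n : ℝ) + 1) * x : ℝ) + (((n : ℝ) + 1) * θ : ℝ) * Complex.I) := by
  rw [← Complex.exp_nat_mul]
  congr 1
  push_cast
  ring

theorem exp_re_im (x θ : ℝ) : (Complex.exp (x + θ * Complex.I)).re = Real.exp x * Real.cos θ ∧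
    (Complex.exp (x + θ * Complex.I)).im = Real.exp x * Real.sin θ := by
  simp [Complex.exp_re, Complex.exp_im]

theorem hasSum_log_norm_one_sub {c : ℝ} (hc : 0 < c) (θ : ℝ) :
    HasSum (fun n : ℕ => -(Real.exp (-(((n : ℝ) + 1) * c)) / ((n : ℝ) + 1)) *
      Real.cos (((n : ℝ) + 1) * θ))
      (Real.log ‖1 - Complex.exp ((-c : ℝ) + θ * Complex.I)‖) := by
  have hu : ‖Complex.exp ((-c : ℝ) + θ * Complex.I)‖ < 1 := by
    rw [norm_exp_real_add_mul_I]; simpa using hc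
  have h := (Complex.hasSum_taylorSeries_neg_log hu).neg
  -- The dropped term n = 0 is u⁰/0 = 0.
  have h2 := Complex.hasSum_re ((hasSum_nat_add_iff' 1).2 h)
  simp only [Finset.range_one, Finset.sum_singleton, Nat.cast_zero, div_zero, neg_zero, sub_zero,
    neg_neg, Complex.log_re] at h2
  convert! h2 using 2 with n
  rw [pow_succ_exp, Complex.neg_re, ← Complex.ofReal_natCast, Complex.div_ofReal_re,
    (exp_re_im _ _).1]
  push_cast
  rw [mul_neg]
  ring

theorem norm_logPolar_sub_of_lt {x y : ℝ} (h : y < x) (θ φ : ℝ) :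
    Real.log ‖logPolar x θ - logPolar y φ‖ =
      x + Real.log ‖1 - Complex.exp ((-(x - y) : ℝ) + (θ - φ : ℝ) * Complex.I)‖ := by
  -- Factoring out the larger point leaves the angle -(θ - φ); conjugation then reverses its sign
  -- without changing the norm.
  have h1 : logPolar x θ - logPolar y φ = logPolar x φ * (Complex.exp ((0 : ℝ) + (θ - φ : ℝ) *
      Complex.I) * (1 - Complex.exp ((-(x - y) : ℝ) + (-(θ - φ) : ℝ) * Complex.I))) := by
    simp only [logPolar, mul_sub, mul_one, ← Complex.exp_add]
    push_cast
    congr 2 <;> ring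
  have h2 : ‖1 - Complex.exp ((-(x - y) : ℝ) + (-(θ - φ) : ℝ) * Complex.I)‖ =
      ‖1 - Complex.exp ((-(x - y) : ℝ) + (θ - φ : ℝ) * Complex.I)‖ := by
    rw [← Complex.norm_conj]
    congr 1
    rw [map_sub, map_one, ← Complex.exp_conj]
    congr 2
    simp
    ring
  have h3 : Complex.exp ((-(x - y) : ℝ) + (θ - φ : ℝ) * Complex.I) ≠ 1 := fun hc => by
    have := norm_exp_real_add_mul_I (-(x - y)) (θ - φ)
    rw [hc, norm_one, eq_comm, Real.exp_eq_one_iff] at this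
    linarith
  rw [h1, norm_mul, norm_mul, h2, logPolar, norm_exp_real_add_mul_I, norm_exp_real_add_mul_I,
    Real.exp_zero, one_mul, Real.log_mul (Real.exp_pos _).ne'
      (by simpa [sub_eq_zero] using h3.symm), Real.log_exp]

/-- Factor out the point of larger modulus, whose logarithm is max(x, y), and expand log|1 - u| with
|u| = exp(-|x - y|). -/
theorem hasSum_log_norm_logPolar_sub {x y : ℝ} (h : x ≠ y) (θ φ : ℝ) :
    HasSum (fun n : ℕ => -(Real.exp (-(((n : ℝ) + 1) * |x - y|)) / ((n : ℝ) + 1)) *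
      Real.cos (((n : ℝ) + 1) * (θ - φ)))
      (Real.log ‖logPolar x θ - logPolar y φ‖ - max x y) := by
  rcases lt_or_gt_of_ne h with h | h
  · rw [norm_sub_rev, norm_logPolar_sub_of_lt h, max_eq_right h.le, abs_sub_comm,
      abs_of_pos (sub_pos.2 h), add_sub_cancel_left]
    have h1 := hasSum_log_norm_one_sub (sub_pos.2 h) (φ - θ)
    convert! h1 using 3 with n
    rw [← Real.cos_neg]
    congr 1; ring
  · rw [norm_logPolar_sub_of_lt h, max_eq_left h.le, abs_of_pos (sub_pos.2 h),
      add_sub_cancel_left]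
    exact hasSum_log_norm_one_sub (sub_pos.2 h) (θ - φ)

theorem exp_mul_logJac₀ (x θ : ℝ) :
    Real.exp (2 * x) * logJac₀ (logPolar x θ) =
      Real.sin θ / (Real.exp x + Real.exp (-x) - 2 * Real.cos θ) := by
  have h1 : (logPolar x θ).re * (logPolar x θ - 1).im - (logPolar x θ).im * (logPolar x θ - 1).re =
      Real.exp x * Real.sin θ := by
    rw [← (exp_re_im x θ).2, ← logPolar]; simp; ring
  have h2 : Complex.normSq (logPolar x θ) = Real.exp x * Real.exp x := by
    rw [Complex.normSq_eq_norm_sq, logPolar, norm_exp_real_add_mul_I, sq]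
  have h3 : Complex.normSq (logPolar x θ - 1) =
      Real.exp x * (Real.exp x + Real.exp (-x) - 2 * Real.cos θ) := by
    have h4 : Real.exp x * Real.exp (-x) = 1 := by rw [← Real.exp_add]; simp
    rw [Complex.normSq_apply, Complex.sub_re, Complex.sub_im, logPolar, (exp_re_im x θ).1,
      (exp_re_im x θ).2, Complex.one_re, Complex.one_im]
    linear_combination Real.exp x ^ 2 * Real.sin_sq_add_cos_sq θ - h4
  have h5 : Real.exp (2 * x) = Real.exp x * Real.exp x := by rw [← Real.exp_add]; congr 1; ring
  have h6 := (Real.exp_pos x).ne'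
  rw [logJac₀, logJac, h1, h2, h3, h5, mul_div_mul_comm]
  rw [show Real.exp x * Real.exp x * (Real.exp x / (Real.exp x * Real.exp x) *
    (Real.sin θ / (Real.exp x * (Real.exp x + Real.exp (-x) - 2 * Real.cos θ)))) =
    Real.exp x * (Real.sin θ / (Real.exp x * (Real.exp x + Real.exp (-x) - 2 * Real.cos θ))) by
      field_simp, ← mul_div_assoc, mul_div_mul_left _ _ h6]

/-- This is the conjugate Poisson kernel, the imaginary part of 1/(1 - u) with u = exp(-|x| + iθ).
Being a pure sine series, it annihilates the constant term max(x, y) of the logarithm. -/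
theorem hasSum_exp_mul_logJac₀ {x : ℝ} (hx : x ≠ 0) (θ : ℝ) :
    HasSum (fun n : ℕ => Real.exp (-(((n : ℝ) + 1) * |x|)) * Real.sin (((n : ℝ) + 1) * θ))
      (Real.exp (2 * x) * logJac₀ (logPolar x θ)) := by
  have hc : 0 < |x| := abs_pos.2 hx
  have hsym : Real.exp x + Real.exp (-x) = Real.exp |x| + Real.exp (-|x|) := by
    rcases abs_cases x with ⟨h, -⟩ | ⟨h, -⟩ <;> rw [h]
    rw [neg_neg, add_comm]
  rw [exp_mul_logJac₀, hsym]
  generalize |x| = c at hc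
  set u := Complex.exp ((-c : ℝ) + θ * Complex.I) with hu
  have hun : ‖u‖ < 1 := by rw [hu, norm_exp_real_add_mul_I]; simpa using hc
  have h := Complex.hasSum_im ((hasSum_nat_add_iff' 1).2 (hasSum_geometric_of_norm_lt_one hun))
  simp only [Finset.range_one, Finset.sum_singleton, pow_zero, Complex.sub_im, Complex.one_im,
    sub_zero] at h
  convert! h using 1
  · funext n
    rw [hu, pow_succ_exp, (exp_re_im _ _).2, mul_neg]
  · have h4 : Real.exp c * Real.exp (-c) = 1 := by rw [← Real.exp_add]; simp
    have h3 : Complex.normSq (1 - u) =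
        Real.exp (-c) * (Real.exp c + Real.exp (-c) - 2 * Real.cos θ) := by
      rw [Complex.normSq_apply, Complex.sub_re, Complex.sub_im, hu, (exp_re_im _ θ).1,
        (exp_re_im _ θ).2, Complex.one_re, Complex.one_im]
      linear_combination Real.exp (-c) ^ 2 * Real.sin_sq_add_cos_sq θ - h4
    rw [Complex.inv_im, h3, Complex.sub_im, Complex.one_im, zero_sub, neg_neg, hu,
      (exp_re_im _ θ).2, mul_div_mul_left _ _ (Real.exp_pos _).ne']

/-! ### The radial integrals -/

/-- The self-convolution of exp(-k|y|): the segment [0, x], where the exponent is constant,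
contributes x, and each outer ray contributes 1/(2k). -/
theorem integral_exp_abs_sub_add_abs_of_nonneg {k x : ℝ} (hk : 0 < k) (hx : 0 ≤ x) :
    Integrable (fun y => Real.exp (-(k * (|x - y| + |y|)))) ∧
      ∫ y, Real.exp (-(k * (|x - y| + |y|))) = (x + 1 / k) * Real.exp (-(k * x)) := by
  set f : ℝ → ℝ := fun y => Real.exp (-(k * (|x - y| + |y|))) with hf
  have e1 : Set.EqOn f (fun y => Real.exp (-(k * x)) * Real.exp (2 * k * y)) (Set.Iic 0) := by
    intro y (hy : y ≤ 0)
    simp only [hf]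
    rw [abs_of_nonneg (by linarith : 0 ≤ x - y), abs_of_nonpos hy, ← Real.exp_add]
    congr 1; ring
  have e2 : Set.EqOn f (fun _ => Real.exp (-(k * x))) (Set.Ioc 0 x) := by
    intro y hy
    simp only [hf]
    rw [abs_of_nonneg (by linarith [hy.2] : 0 ≤ x - y), abs_of_pos hy.1]
    congr 1; ring
  have e3 : Set.EqOn f (fun y => Real.exp (k * x) * Real.exp (-(2 * k) * y)) (Set.Ioi x) := by
    intro y (hy : x < y)
    simp only [hf]
    rw [abs_of_nonpos (by linarith : x - y ≤ 0), abs_of_nonneg (by linarith), ← Real.exp_add]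
    congr 1; ring
  have i1 : IntegrableOn f (Set.Iic 0) :=
    IntegrableOn.congr_fun ((integrableOn_exp_mul_Iic (by positivity : 0 < 2 * k) 0).const_mul _)
      e1.symm measurableSet_Iic
  have i2 : IntegrableOn f (Set.Ioc 0 x) :=
    IntegrableOn.congr_fun (integrableOn_const (by simp)) e2.symm measurableSet_Ioc
  have i3 : IntegrableOn f (Set.Ioi x) :=
    IntegrableOn.congr_fun ((integrableOn_exp_mul_Ioi (by linarith : -(2 * k) < 0) x).const_mul _)
      e3.symm measurableSet_Ioi
  have i23 : IntegrableOn f (Set.Ioi 0) := by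
    rw [← Set.Ioc_union_Ioi_eq_Ioi hx]; exact i2.union i3
  refine ⟨?_, ?_⟩
  · rw [← integrableOn_univ, ← Set.Iic_union_Ioi (a := (0 : ℝ))]
    exact i1.union i23
  · rw [← intervalIntegral.integral_Iic_add_Ioi i1 i23, ← Set.Ioc_union_Ioi_eq_Ioi hx,
      setIntegral_union (Set.Ioc_disjoint_Ioi le_rfl) measurableSet_Ioi i2 i3,
      setIntegral_congr_fun measurableSet_Iic e1, setIntegral_congr_fun measurableSet_Ioc e2,
      setIntegral_congr_fun measurableSet_Ioi e3, integral_const_mul, integral_const_mul,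
      integral_exp_mul_Iic (by positivity), integral_exp_mul_Ioi (by linarith), setIntegral_const,
      Real.volume_real_Ioc_of_le hx, smul_eq_mul]
    have : Real.exp (k * x) * Real.exp (-(2 * k) * x) = Real.exp (-(k * x)) := by
      rw [← Real.exp_add]; congr 1; ring
    rw [mul_zero, Real.exp_zero, neg_div_neg_eq,
      ← mul_div_assoc (Real.exp (k * x)), this]
    field_simp
    ring

theorem integral_exp_abs_sub_add_abs {k : ℝ} (hk : 0 < k) (x : ℝ) :
    Integrable (fun y => Real.exp (-(k * (|x - y| + |y|)))) ∧
      ∫ y, Real.exp (-(k * (|x - y| + |y|))) = (|x| + 1 / k) * Real.exp (-(k * |x|)) := by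
  rcases le_total 0 x with hx | hx
  · rw [abs_of_nonneg hx]
    exact integral_exp_abs_sub_add_abs_of_nonneg hk hx
  · obtain ⟨h1, h2⟩ := integral_exp_abs_sub_add_abs_of_nonneg hk (neg_nonneg.2 hx)
    have e : ∀ y : ℝ, |-x - -y| + |-y| = |x - y| + |y| := fun y => by
      rw [abs_neg, ← abs_neg (x - y)]; congr 2; ring
    rw [abs_of_nonpos hx]
    refine ⟨?_, ?_⟩
    · have := h1.comp_neg
      simpa only [e] using this
    · have h := integral_neg_eq_self (fun y => Real.exp (-(k * (|-x - y| + |y|)))) volume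
      simp only [e] at h
      rw [h, h2]

theorem integral_abs_add_mul_exp {k : ℝ} (hk : 0 < k) :
    Integrable (fun x => (|x| + 1 / k) * Real.exp (-(2 * k * |x|))) ∧
      ∫ x, (|x| + 1 / k) * Real.exp (-(2 * k * |x|)) = 3 / (2 * k ^ 2) := by
  have hd : ∀ x ∈ Set.Ioi (0 : ℝ), HasDerivAt
      -- An explicit primitive vanishing at infinity; its value -3/(4k²) at 0, doubled by evenness,
      -- gives the result.
      (fun x => -(x / (2 * k) + 3 / (4 * k ^ 2)) * Real.exp (-(2 * k * x)))
      ((x + 1 / k) * Real.exp (-(2 * k * x))) x := fun x _ => by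
    have h1 : HasDerivAt (fun x : ℝ => -(x / (2 * k) + 3 / (4 * k ^ 2))) (-(1 / (2 * k))) x :=
      (((hasDerivAt_id x).div_const _).add_const _).neg
    have h2 : HasDerivAt (fun x : ℝ => Real.exp (-(2 * k * x)))
        (Real.exp (-(2 * k * x)) * (-(2 * k * 1))) x :=
      (((hasDerivAt_id x).const_mul (2 * k)).neg).exp
    convert! h1.mul h2 using 1
    field_simp
    ring
  have hcont : ContinuousWithinAt
      (fun x => -(x / (2 * k) + 3 / (4 * k ^ 2)) * Real.exp (-(2 * k * x))) (Set.Ici 0) 0 := by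
    fun_prop
  have hlim : Filter.Tendsto
      (fun x : ℝ => -(x / (2 * k) + 3 / (4 * k ^ 2)) * Real.exp (-(2 * k * x))) Filter.atTop
      (nhds 0) := by
    have h1 : Filter.Tendsto (fun x : ℝ => 2 * k * x) Filter.atTop Filter.atTop :=
      Filter.tendsto_id.const_mul_atTop (by positivity)
    have h2 := (Real.tendsto_pow_mul_exp_neg_atTop_nhds_zero 1).comp h1
    have h3 := Real.tendsto_exp_neg_atTop_nhds_zero.comp h1
    have h4 := (h2.const_mul (-(1 / (4 * k ^ 2)))).add (h3.const_mul (-(3 / (4 * k ^ 2))))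
    simp only [mul_zero, add_zero] at h4
    refine h4.congr fun x => ?_
    simp only [Function.comp]
    field_simp
    ring
  have hnn : ∀ x ∈ Set.Ioi (0 : ℝ), 0 ≤ (x + 1 / k) * Real.exp (-(2 * k * x)) :=
    fun x (hx : 0 < x) => by positivity
  have hi := integrableOn_Ioi_deriv_of_nonneg hcont hd hnn hlim
  have hv := integral_Ioi_of_hasDerivAt_of_nonneg hcont hd hnn hlim
  have hi' : IntegrableOn (fun x => (|x| + 1 / k) * Real.exp (-(2 * k * |x|))) (Set.Ioi 0) :=
    hi.congr_fun (fun x (hx : 0 < x) => by simp only [abs_of_pos hx]) measurableSet_Ioi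
  constructor
  · rw [← integrableOn_univ, ← Set.Iic_union_Ioi (a := (0 : ℝ))]
    refine IntegrableOn.union ?_ hi'
    have := (integrableOn_Ici_iff_integrableOn_Ioi (by simp)).2 hi'
    rw [← neg_zero] at this
    simpa using this.comp_neg_Iic
  · rw [integral_comp_abs (f := fun x => (x + 1 / k) * Real.exp (-(2 * k * x))), hv]
    simp
    field_simp
    norm_num

/-! ### The logarithmic potential and the value of the main integral -/

theorem integrable_log_norm_sub_mul_logJac₀ (z : ℂ) :
    Integrable fun w : ℂ => Real.log ‖z - w‖ * logJac₀ w := by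
  have h1 : Integrable fun w : ℂ => radialBound ‖z - w‖ := by
    simpa only [norm_sub_rev] using integrable_radialBound_norm.comp_sub_right z
  refine Integrable.mono' ((((h1.const_mul 16).add integrable_logJac₀_mul_sqrt).add
    (integrable_logJac₀.abs.const_mul (Real.log (1 + ‖z‖)))).add integrable_log_mul_logJac₀)
    (by fun_prop) (.of_forall fun w => ?_)
  simp only [Pi.add_apply, norm_mul, Real.norm_eq_abs]
  have h2 := abs_log_mul_le (norm_nonneg (z - w)) (abs_nonneg (logJac₀ w))
  have h3 : Real.log (1 + ‖z - w‖) ≤ Real.log (1 + ‖z‖) + Real.log (1 + ‖w‖) := by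
    rw [← Real.log_mul (by positivity) (by positivity)]
    refine Real.log_le_log (by positivity) ?_
    nlinarith [norm_sub_le z w, norm_nonneg z, norm_nonneg w]
  have h4 := mul_le_mul_of_nonneg_right h3 (abs_nonneg (logJac₀ w))
  linarith

/-- The Fourier coefficients of the logarithmic potential of `logJac₀`, up to the factor `-π`. -/
noncomputable def potentialCoeff (x : ℝ) (n : ℕ) : ℝ :=
  (|x| + 1 / ((n : ℝ) + 1)) * Real.exp (-(((n : ℝ) + 1) * |x|)) / ((n : ℝ) + 1)

theorem potentialCoeff_nonneg (x : ℝ) (n : ℕ) : 0 ≤ potentialCoeff x n := by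
  unfold potentialCoeff; positivity

theorem summable_potentialCoeff {x : ℝ} (hx : x ≠ 0) : Summable (potentialCoeff x) := by
  refine Summable.of_nonneg_of_le (potentialCoeff_nonneg x) (fun n => ?_)
    ((summable_exp_neg_mul (abs_pos.2 hx)).mul_left (|x| + 1))
  have h1 : 1 / ((n : ℝ) + 1) ≤ 1 := by
    rw [div_le_one (by positivity)]; linarith [(Nat.cast_nonneg n : (0 : ℝ) ≤ n)]
  unfold potentialCoeff
  refine (div_le_self (by positivity) (by linarith [(Nat.cast_nonneg n : (0 : ℝ) ≤ n)])).trans ?_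
  gcongr

theorem summable_abs_exp_div {c : ℝ} (hc : 0 < c) :
    Summable fun n : ℕ => Real.exp (-(((n : ℝ) + 1) * c)) / ((n : ℝ) + 1) := by
  refine Summable.of_nonneg_of_le (fun n => by positivity) (fun n => ?_) (summable_exp_neg_mul hc)
  exact div_le_self (Real.exp_pos _).le (by linarith [(Nat.cast_nonneg n : (0 : ℝ) ≤ n)])

/-- Writing cos n(θ - φ) as cos cos + sin sin, Parseval in φ keeps only the sine part, and the
exponentials multiply. -/
theorem integral_log_norm_sub_mul_circle {x y : ℝ} (hy : y ≠ 0) (hxy : x ≠ y) (θ : ℝ) :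
    HasSum (fun n : ℕ => -Real.pi * (Real.sin (((n : ℝ) + 1) * θ) / ((n : ℝ) + 1)) *
        Real.exp (-(((n : ℝ) + 1) * (|x - y| + |y|))))
      (∫ φ in Set.Ioo (-Real.pi) Real.pi, Real.log ‖logPolar x θ - logPolar y φ‖ *
        (Real.exp (2 * y) * logJac₀ (logPolar y φ))) := by
  have hs := summable_abs_exp_div (abs_pos.2 (sub_ne_zero.2 hxy))
  have hb : ∀ (t : ℕ → ℝ), (∀ n, |t n| ≤ 1) → Summable fun n : ℕ =>
      |-(Real.exp (-(((n : ℝ) + 1) * |x - y|)) / ((n : ℝ) + 1)) * t n| := fun t ht => by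
    refine Summable.of_nonneg_of_le (fun n => abs_nonneg _) (fun n => ?_) hs
    rw [abs_mul, abs_neg, abs_of_nonneg (by positivity :
      0 ≤ Real.exp (-(((n : ℝ) + 1) * |x - y|)) / ((n : ℝ) + 1))]
    exact mul_le_of_le_one_right (by positivity) (ht n)
  have h := hasSum_integral_mul_sineSeries (max x y)
    (hb (fun n => Real.cos (((n : ℝ) + 1) * θ)) fun n => Real.abs_cos_le_one _)
    (hb (fun n => Real.sin (((n : ℝ) + 1) * θ)) fun n => Real.abs_sin_le_one _)
    (c := fun n => Real.exp (-(((n : ℝ) + 1) * |y|)))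
    (by simpa only [abs_of_pos (Real.exp_pos _)] using summable_exp_neg_mul (abs_pos.2 hy))
    (f := fun φ => Real.log ‖logPolar x θ - logPolar y φ‖)
    (g := fun φ => Real.exp (2 * y) * logJac₀ (logPolar y φ)) ?_ (hasSum_exp_mul_logJac₀ hy)
  · convert! h using 2 with n
    rw [mul_add, neg_add, Real.exp_add]
    ring
  · intro φ
    convert! hasSum_log_norm_logPolar_sub hxy θ φ using 2 with n
    rw [mul_sub, Real.cos_sub]
    ring

/-- Integrate the circle formula over the radius y; each mode contributes the self-convolution of an
exponential. -/
theorem hasSum_potential {x : ℝ} (hx : x ≠ 0) (θ : ℝ) :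
    HasSum (fun n : ℕ => -Real.pi * potentialCoeff x n * Real.sin (((n : ℝ) + 1) * θ))
      (∫ w, Real.log ‖logPolar x θ - w‖ * logJac₀ w) := by
  rw [(integrable_logPolar_and_integral (integrable_log_norm_sub_mul_logJac₀ _)).2]
  set F : ℕ → ℝ → ℝ := fun n y => -Real.pi * (Real.sin (((n : ℝ) + 1) * θ) / ((n : ℝ) + 1)) *
        Real.exp (-(((n : ℝ) + 1) * (|x - y| + |y|))) with hF
  have hpos : ∀ n : ℕ, 0 < (n : ℝ) + 1 := fun n => by positivity
  have hI := fun n : ℕ => integral_exp_abs_sub_add_abs (hpos n) x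
  have key := hasSum_integral_of_summable_integral_norm (F := F) (μ := volume)
    (fun n => (hI n).1.const_mul _) ?_
  · have h1 : ∫ y, ∑' n, F n y = ∫ y, ∫ φ in Set.Ioo (-Real.pi) Real.pi, Real.exp (2 * y) *
        (Real.log ‖logPolar x θ - logPolar y φ‖ * logJac₀ (logPolar y φ)) := by
      refine integral_congr_ae ?_
      filter_upwards [Measure.ae_ne volume 0, Measure.ae_ne volume x] with y h0 hx
      rw [(integral_log_norm_sub_mul_circle h0 hx.symm θ).tsum_eq]
      congr 1
      funext φ
      ring
    rw [h1] at key
    convert! key using 2 with n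
    simp only [hF]
    rw [integral_const_mul, (hI n).2, potentialCoeff]
    ring
  · refine Summable.of_nonneg_of_le (fun n => integral_nonneg fun y => norm_nonneg _)
      (fun n => ?_) ((summable_potentialCoeff hx).mul_left Real.pi)
    have h2 : ∀ y, ‖F n y‖ ≤ Real.pi * (1 / ((n : ℝ) + 1)) *
        Real.exp (-(((n : ℝ) + 1) * (|x - y| + |y|))) := fun y => by
      simp only [hF, norm_mul, Real.norm_eq_abs, abs_neg, abs_div, abs_of_pos Real.pi_pos,
        abs_of_pos (hpos n), abs_of_pos (Real.exp_pos _)]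
      gcongr
      exact Real.abs_sin_le_one _
    refine (integral_mono ((hI n).1.const_mul _).norm ((hI n).1.const_mul _) h2).trans ?_
    rw [integral_const_mul, (hI n).2, potentialCoeff]
    exact le_of_eq (by ring)

theorem hasSum_integral_potential_circle {x : ℝ} (hx : x ≠ 0) :
    HasSum (fun n : ℕ => -Real.pi ^ 2 / ((n : ℝ) + 1) * ((|x| + 1 / ((n : ℝ) + 1)) *
        Real.exp (-(2 * ((n : ℝ) + 1) * |x|))))
      (∫ θ in Set.Ioo (-Real.pi) Real.pi, (∫ w, Real.log ‖logPolar x θ - w‖ * logJac₀ w) *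
        (Real.exp (2 * x) * logJac₀ (logPolar x θ))) := by
  have h := hasSum_integral_mul_sineSeries (a := 0) (b := fun n => -Real.pi * potentialCoeff x n)
    (c := fun n => Real.exp (-(((n : ℝ) + 1) * |x|))) 0 (by simp)
    (by simpa only [abs_mul, abs_of_nonneg (potentialCoeff_nonneg x _)] using
      (summable_potentialCoeff hx).mul_left |(-Real.pi)|)
    (by simpa only [abs_of_pos (Real.exp_pos _)] using summable_exp_neg_mul (abs_pos.2 hx))
    (f := fun θ => ∫ w, Real.log ‖logPolar x θ - w‖ * logJac₀ w)
    (by simpa using hasSum_potential hx) (hasSum_exp_mul_logJac₀ hx)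
  convert! h using 2 with n
  have : Real.exp (-(2 * ((n : ℝ) + 1) * |x|)) =
      Real.exp (-(((n : ℝ) + 1) * |x|)) * Real.exp (-(((n : ℝ) + 1) * |x|)) := by
    rw [← Real.exp_add]; congr 1; ring
  rw [this, potentialCoeff]
  ring

theorem hasSum_integral_mainTerm :
    HasSum (fun n : ℕ => -(3 / 2) * Real.pi ^ 2 * (1 / ((n : ℝ) + 1) ^ 3))
      (∫ x, mainTerm x) := by
  have hm := integrable_mainTerm
  rw [Measure.volume_eq_prod] at hm
  rw [Measure.volume_eq_prod, integral_prod _ hm,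
    (integrable_logPolar_and_integral hm.integral_prod_left).2]
  set F : ℕ → ℝ → ℝ := fun n x => -Real.pi ^ 2 / ((n : ℝ) + 1) * ((|x| + 1 / ((n : ℝ) + 1)) *
        Real.exp (-(2 * ((n : ℝ) + 1) * |x|))) with hF
  have hpos : ∀ n : ℕ, 0 < (n : ℝ) + 1 := fun n => by positivity
  have hI := fun n : ℕ => integral_abs_add_mul_exp (hpos n)
  have h3 : Summable fun n : ℕ => 1 / ((n : ℝ) + 1) ^ 3 := by
    have := (summable_nat_add_iff 1).2 (Real.summable_one_div_nat_pow.2 (by norm_num : 1 < 3))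
    exact this.congr fun n => by push_cast; rfl
  have hv : ∀ n : ℕ, ∫ x, F n x = -(3 / 2) * Real.pi ^ 2 * (1 / ((n : ℝ) + 1) ^ 3) := fun n => by
    have := hpos n
    simp only [hF]
    rw [integral_const_mul, (hI n).2]
    field_simp
  -- All terms have the same sign, so convergence of ∑ 1/n³ already gives the absolute summability
  -- needed to exchange sum and integral.
  have hn : ∀ n : ℕ, ∀ x, ‖F n x‖ = -F n x := fun n x => by
    have := hpos n
    rw [Real.norm_eq_abs, abs_of_nonpos]
    simp only [hF, neg_div, neg_mul]
    exact neg_nonpos.2 (by positivity)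
  have key := hasSum_integral_of_summable_integral_norm (F := F) (μ := volume)
    (fun n => (hI n).1.const_mul _)
    (by simpa only [hn, integral_neg, hv] using (h3.mul_left (-(3 / 2) * Real.pi ^ 2)).neg)
  simp only [hv] at key
  convert! key using 1
  refine integral_congr_ae ?_
  filter_upwards [Measure.ae_ne volume 0] with x hx
  rw [(hasSum_integral_potential_circle hx).tsum_eq]
  congr 1
  funext θ
  have : ∀ w, mainTerm (logPolar x θ, w) =
      logJac₀ (logPolar x θ) * (Real.log ‖logPolar x θ - w‖ * logJac₀ w) := fun w => by
    simp only [mainTerm]; ring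
  simp only [this]
  rw [integral_const_mul]
  ring

theorem integral_mainTerm :
    ((∫ x, mainTerm x : ℝ) : ℂ) = -(3 / 2) * (Real.pi : ℂ) ^ 2 * riemannZeta 3 := by
  have h := zeta_eq_tsum_one_div_nat_add_one_cpow (s := 3) (by norm_num)
  rw [h, ← hasSum_integral_mainTerm.tsum_eq, Complex.ofReal_tsum, ← tsum_mul_left]
  refine tsum_congr fun n => ?_
  have h3 : ((n : ℂ) + 1) ^ (3 : ℂ) = ((n : ℂ) + 1) ^ 3 := by
    exact_mod_cast Complex.cpow_natCast ((n : ℂ) + 1) 3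
  rw [h3]
  push_cast
  rfl

end GraphWeight

theorem mainTheorem9 (Γ : GraphWeight.DirGraph 4 6) (hΓ : Γ.IsTetrahedron) :
    MeasureTheory.IntegrableOn (GraphWeight.weightDensity (m := 2) (1 / 2) Γ)
        (GraphWeight.ConfQuot 2) ∧
      ∃ q : ℚ, q ≠ 0 ∧
        GraphWeight.weight (m := 2) (1 / 2) Γ =
          (q : ℂ) * Complex.I * (riemannZeta 3 / (Real.pi : ℂ) ^ 3) := by
  obtain ⟨h, s, hs⟩ := GraphWeight.integrableOn_weightDensity_and_weight hΓ
  -- The modulus is 5 · (3/2) / 2⁴: five equal integrals, the constant of the main integral, and the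
  -- four propagator factors 1/2.
  refine ⟨h, (s : ℤ) * (15 / 32), by simp, ?_⟩
  have hpi : (Real.pi : ℂ) ≠ 0 := by exact_mod_cast Real.pi_ne_zero
  rw [hs, Complex.ofReal_mul, GraphWeight.integral_mainTerm]
  push_cast
  field_simp
  simp [Complex.I_pow_eq_pow_mod]
  linear_combination (-480 * riemannZeta 3) * Complex.I_sq
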